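/- **Setting.** Let $\mathsf X,\mathsf Y$ be measurable spaces with $\sigma$-finite reference measures (for instance subsets of Euclidean spaces with Lebesgue measure; write $\mathrm dx$ for the reference measure on $\mathsf X$). Consider a state-space model with initial density $\mu(x_1)$, transition density $f(x'|x)$ and observation density $g(y|x)$, a time horizon $T\ge 1$ and fixed observations $y_{1:T}$. The smoothing distribution on $\mathsf X^T$ is $$\pi(x_{1:T})=\frac{\mu(x_1)g(y_1|x_1)\prod_{t=2}^T f(x_t|x_{t-1})g(y_t|x_t)}{p(y_{1:T})},$$ where $p(y_{1:T})$ is the normalizing constant, and $\pi(h)=\int h\,\mathrm d\pi$ for measurable $h:\mathsf X^T\to\mathbb R$. *Particle filter.* Let $q_1(x_1)$ and $q_t(x_t|x_{t-1})$, $2\le t\le T$, be proposal densities, with incremental weights $$w_1(x_1)=\frac{g(y_1|x_1)\mu(x_1)}{q_1(x_1)},\qquad w_t(x_{t-1},x_t)=\frac{g(y_t|x_t)f(x_t|x_{t-1})}{q_t(x_t|x_{t-1})}.$$ These are assumed positive wherever the proposal density in the denominator is non-zero; where it vanishes, the numerator is assumed to vanish, and $w:=0$ there. Let $N\ge 1$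 and let $r(\cdot|W)$ be a resampling scheme, i.e. a Markov kernel from weight vectors to $[N]^N$, $[N]=\{1,\dots,N\}$. A call to the particle filter draws $X_1^1,\dots,X_1^N$ i.i.d. from $q_1$ and sets $W_1^i\propto w_1(X_1^i)$, $p_N=\frac1N\sum_i w_1(X_1^i)$. For $t=2,\dots,T$ it draws ancestors $A_{t-1}^{1:N}\sim r(\cdot|W_{t-1})$ and, independently given these, $X_t^i\sim q_t(\cdot|X_{t-1}^{A_{t-1}^i})$; it sets $X_{1:t}^i=(X_{1:t-1}^{A_{t-1}^i},X_t^i)$ and $W_t^i\propto v_t^i:=w_t(X_{t-1}^{A_{t-1}^i},X_t^i)$, and multiplies $p_N$ by $\frac1N\sum_i v_t^i$. Finally it draws $J$ with $\mathbb P(J=i)=W_T^i$ and returns the particle system, $X_{1:T}=X_{1:T}^J$ and $p_N$. Write $\pi_N(h)=\sum_i W_T^i h(X_{1:T}^i)$. *Coupled PIMH.* Let $\alpha(p,p^*)=1\wedge p^*/p$. The initial state $\xi^{(0)}$ of the first chain is the output of a call to the particle filter. In iteration $n=1,2,\dots$ draw, independently of everything before, a proposal $\xi^*$ from the particle filter,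 with likelihood estimate $p_N^*$, and $\mathfrak u\sim\mathcal U[0,1]$. If $\mathfrak u\le\alpha(p_N^{(n-1)},p_N^*)$ set $\xi^{(n)}=\xi^*$, otherwise $\xi^{(n)}=\xi^{(n-1)}$. If $\mathfrak u\le\alpha(\tilde p_N^{(n-2)},p_N^*)$ set $\tilde\xi^{(n-1)}=\xi^*$, otherwise $\tilde\xi^{(n-1)}=\tilde\xi^{(n-2)}$, with the convention $\alpha(\tilde p_N^{(-1)},\cdot)=1$ (so $\tilde\xi^{(0)}$ is the proposal of iteration $1$). Quantities attached to $\xi^{(n)}$, resp. $\tilde\xi^{(n)}$, carry a superscript $(n)$, resp. also a tilde. The meeting time $\tau$ is the first $n\ge1$ at which both chains accept the proposal ($\tau=\infty$ if there is none). For $0\le k\le m$ put $$H_{k:m}=\frac1{m-k+1}\sum_{l=k}^m h(X_{1:T}^{(l)})+\sum_{l=k+1}^{\tau-1}\min\Big(1,\frac{l-k}{m-k+1}\Big)\big(h(X_{1:T}^{(l)})-h(\tilde X_{1:T}^{(l-1)})\big),$$ and let $\bar H_{k:m}$ be the same expression with $h(X_{1:T}^{(l)})$, $h(\tilde X_{1:T}^{(l-1)})$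 replaced by $\pi_N^{(l)}(h)$, $\tilde\pi_N^{(l-1)}(h)$. The iterations are run up to $\max(m,\tau)$; the cost is the number $1+\max(m,\tau)$ of calls to the particle filter. **Proposition.** Assume that the resampling scheme is unbiased, i.e. $\sum_{i=1}^N r(A^i=k|W)=NW^k$ for all $k\in[N]$ and all $W$ in the probability simplex, and that there are finite constants $\bar w_1,\dots,\bar w_T$ with $w_1\le\bar w_1$ and $w_t\le\bar w_t$ everywhere for $2\le t\le T$. Let $0\le k\le m$. 1. If there are $\eta>0$ and $D<\infty$ with $\mathbb E\big[|h(X_{1:T}^{(n)})|^{2+\eta}\big]<D$ for all $n\ge0$, then $h$ is $\pi$-integrable, $\mathbb E[H_{k:m}]=\pi(h)$, $H_{k:m}$ has finite variance, and its expected cost is finite. 2. If $\pi(h)$ is well defined ($h$ is $\pi$-integrable) and there are $\eta>0$ and $D<\infty$ with $\mathbb E\big[|\pi_N^{(n)}(h)|^{2+\eta}\big]<D$ for all $n\ge0$, then $\mathbb E[\bar H_{k:m}]=\pi(h)$, $\bar H_{k:m}$ has finite variance, and its expected cost is finite. -/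

import Mathlib

open MeasureTheory ProbabilityTheory
open scoped ENNReal NNReal

noncomputable section

namespace CoupledPIMH

/-! ### State-space model, proposals, smoothing distribution -/

/-- `p` is a probability density with respect to the reference measure `ν`. -/
def IsDensity {E : Type*} [MeasurableSpace E] (ν : Measure E) (p : E → ℝ) : Prop :=
  Measurable p ∧ (∀ x, 0 ≤ p x) ∧ ∫⁻ x, ENNReal.ofReal (p x) ∂ν = 1

/-- `k x e` is the value at `e` of a conditional probability density given `x`, jointly
measurable in both arguments. -/
def IsCondDensity {X E : Type*} [MeasurableSpace X] [MeasurableSpace E] (ν : Measure E)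
    (k : X → E → ℝ) : Prop :=
  Measurable (Function.uncurry k) ∧ ∀ x, IsDensity ν (k x)

/-- A state-space model on `X × Y`: initial density `mu`, transition density
`f x x' = f(x' | x)` and observation density `g x y = g(y | x)`. -/
structure StateSpaceModel {X Y : Type*} [MeasurableSpace X] [MeasurableSpace Y]
    (ν : Measure X) (ρ : Measure Y) where
  mu : X → ℝ
  f : X → X → ℝ
  g : X → Y → ℝ
  mu_density : IsDensity ν mu
  f_density : IsCondDensity ν f
  g_density : IsCondDensity ρ g

/-- Proposal densities of the particle filter: `q1` at time `1` and
`q t x x' = q_t(x' | x)` at times `t ≥ 2`. -/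
structure Proposal {X : Type*} [MeasurableSpace X] (ν : Measure X) where
  q1 : X → ℝ
  q : ℕ → X → X → ℝ
  q1_density : IsDensity ν q1
  q_density : ∀ t, 2 ≤ t → IsCondDensity ν (q t)

/-- The probability measure with density `p` with respect to `ν`. -/
def densityMeasure {E : Type*} [MeasurableSpace E] (ν : Measure E) (p : E → ℝ) : Measure E :=
  ν.withDensity fun x => ENNReal.ofReal (p x)

section Model

variable {X Y : Type*} [MeasurableSpace X] [MeasurableSpace Y] {ν : Measure X} {ρ : Measure Y}

/-- `μ(x₁) g(y₁ | x₁) ∏_{t=2}^T f(x_t | x_{t-1}) g(y_t | x_t)` with `T = L + 1`; coordinate `i`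
of a path is the state at time `i + 1`. -/
def jointDensity (M : StateSpaceModel ν ρ) (y : ℕ → Y) (L : ℕ) (x : Fin (L + 1) → X) : ℝ :=
  M.mu (x 0) * M.g (x 0) (y 1) *
    ∏ t : Fin L, M.f (x t.castSucc) (x t.succ) * M.g (x t.succ) (y ((t : ℕ) + 2))

/-- The unnormalised smoothing measure; its total mass is the likelihood `p(y_{1:T})`. -/
def jointMeasure (M : StateSpaceModel ν ρ) (y : ℕ → Y) (L : ℕ) : Measure (Fin (L + 1) → X) :=
  densityMeasure (Measure.pi fun _ : Fin (L + 1) => ν) (jointDensity M y L)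

/-- The smoothing distribution `π(dx_{1:T}) = p(x_{1:T} | y_{1:T}) dx_{1:T}`, `T = L + 1`. -/
def smoothing (M : StateSpaceModel ν ρ) (y : ℕ → Y) (L : ℕ) : Measure (Fin (L + 1) → X) :=
  (jointMeasure M y L Set.univ)⁻¹ • jointMeasure M y L

/-- The incremental weight `w₁(x₁)`. -/
def weight1 (M : StateSpaceModel ν ρ) (Q : Proposal ν) (y : ℕ → Y) (x : X) : ℝ :=
  M.g x (y 1) * M.mu x / Q.q1 x

/-- The incremental weight `w_t(x_{t-1}, x_t)`, `t ≥ 2`. -/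
def weight (M : StateSpaceModel ν ρ) (Q : Proposal ν) (y : ℕ → Y) (t : ℕ) (x x' : X) : ℝ :=
  M.g x' (y t) * M.f x x' / Q.q t x x'

/-- The incremental weights up to time `T` are well defined and positive: the weight is positive
wherever the proposal density is, and its numerator vanishes wherever the proposal density does
(there the ratio is `0 / 0`). This holds in particular when all ratios are positive everywhere. -/
def WeightsPositive (M : StateSpaceModel ν ρ) (Q : Proposal ν) (y : ℕ → Y) (T : ℕ) : Prop :=
  (∀ x, (Q.q1 x ≠ 0 → 0 < weight1 M Q y x) ∧ (Q.q1 x = 0 → M.g x (y 1) * M.mu x = 0)) ∧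
  ∀ t, 2 ≤ t → t ≤ T → ∀ x x', (Q.q t x x' ≠ 0 → 0 < weight M Q y t x x') ∧
    (Q.q t x x' = 0 → M.g x' (y t) * M.f x x' = 0)

/-- The incremental weights up to time `T` are bounded. -/
def WeightsBounded (M : StateSpaceModel ν ρ) (Q : Proposal ν) (y : ℕ → Y) (T : ℕ) : Prop :=
  ∃ wbar : ℕ → ℝ, (∀ x, weight1 M Q y x ≤ wbar 1) ∧
    ∀ t, 2 ≤ t → t ≤ T → ∀ x x', weight M Q y t x x' ≤ wbar t

end Model

/-! ### Particle filter -/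

/-- A resampling scheme `r(· | W)` is unbiased if `∑ i, r(A^i = k | W) = N W^k` for all `k` and
all vectors `W` of normalised weights. -/
def UnbiasedResampling {N : ℕ} (r : Kernel (Fin N → ℝ) (Fin N → Fin N)) : Prop :=
  ∀ W ∈ stdSimplex ℝ (Fin N), ∀ k : Fin N,
    ∑ i : Fin N, r W {a | a i = k} = N * ENNReal.ofReal (W k)

/-- The state of the particle filter at time `t + 1`: the paths `X_{1:t+1}^i`, the normalised
weights `W_{t+1}^i` and the likelihood estimate `p_N(y_{1:t+1})`. -/
abbrev PFState (X : Type*) (N t : ℕ) : Type _ := (Fin N → Fin (t + 1) → X) × (Fin N → ℝ) × ℝ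

/-- Normalisation of weights, `W^i ∝ v^i`. -/
def normWeights {N : ℕ} (v : Fin N → ℝ) : Fin N → ℝ := fun i => v i / ∑ j, v j

/-- `(1 / N) ∑ i, v^i`. -/
def avgWeight {N : ℕ} (v : Fin N → ℝ) : ℝ := (1 / (N : ℝ)) * ∑ i, v i

section ParticleFilter

variable {X Y : Type*} [MeasurableSpace X] [MeasurableSpace Y] {ν : Measure X} {ρ : Measure Y}

/-- The state at time `1` built from the particles `x^i = X_1^i`. -/
def initState (M : StateSpaceModel ν ρ) (Q : Proposal ν) (y : ℕ → Y) {N : ℕ} (x : Fin N → X) :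
    PFState X N 0 :=
  (fun i _ => x i, normWeights fun i => weight1 M Q y (x i), avgWeight fun i => weight1 M Q y (x i))

/-- The state at time `t + 2` built from the state at time `t + 1`, the ancestors
`a^i = A_{t+1}^i` and the new particles `x^i = X_{t+2}^i`. -/
def nextState (M : StateSpaceModel ν ρ) (Q : Proposal ν) (y : ℕ → Y) {N t : ℕ}
    (s : PFState X N t) (a : Fin N → Fin N) (x : Fin N → X) : PFState X N (t + 1) :=
  (fun i => Fin.snoc (α := fun _ => X) (s.1 (a i)) (x i),
    normWeights fun i => weight M Q y (t + 2) (s.1 (a i) (Fin.last t)) (x i),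
    s.2.2 * avgWeight fun i => weight M Q y (t + 2) (s.1 (a i) (Fin.last t)) (x i))

/-- The law of the particle filter state at time `t + 1`: at time `1` the particles are i.i.d.
from `q1`; then ancestors are drawn from `r(· | W)` and, given these, the new particles are
independent with densities `q_{t+2}(· | X_{t+1}^{a i})`. -/
def pfLaw (M : StateSpaceModel ν ρ) (Q : Proposal ν) (y : ℕ → Y) {N : ℕ}
    (r : Kernel (Fin N → ℝ) (Fin N → Fin N)) : (t : ℕ) → Measure (PFState X N t)
  | 0 => (Measure.pi fun _ : Fin N => densityMeasure ν Q.q1).map (initState M Q y)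
  | t + 1 => (pfLaw M Q y r t).bind fun s => (r s.2.1).bind fun a =>
      (Measure.pi fun i : Fin N =>
        densityMeasure ν (Q.q (t + 2) (s.1 (a i) (Fin.last t)))).map (nextState M Q y s a)

/-- The output of one call to the particle filter up to time `T = L + 1`: the final state of the
particle filter together with the index `J` of the selected path. -/
abbrev PFRun (X : Type*) (N L : ℕ) : Type _ := PFState X N L × Fin N

/-- The law of the output of one call to the particle filter: `J = i` with probability
`W_T^i`. -/
def pfRunLaw (M : StateSpaceModel ν ρ) (Q : Proposal ν) (y : ℕ → Y) {N : ℕ}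
    (r : Kernel (Fin N → ℝ) (Fin N → Fin N)) (L : ℕ) : Measure (PFRun X N L) :=
  (pfLaw M Q y r L).bind fun s => ∑ j : Fin N, ENNReal.ofReal (s.2.1 j) • Measure.dirac (s, j)

end ParticleFilter

section Run

variable {X : Type*} {N L : ℕ}

/-- The sampled path `X_{1:T} = X_{1:T}^J`. -/
def PFRun.path (v : PFRun X N L) : Fin (L + 1) → X := v.1.1 v.2

/-- The likelihood estimate `p_N = p_N(y_{1:T})`. -/
def PFRun.pN (v : PFRun X N L) : ℝ := v.1.2.2

/-- The particle approximation `π_N(h) = ∑ i, W_T^i h(X_{1:T}^i)`. -/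
def PFRun.piN (h : (Fin (L + 1) → X) → ℝ) (v : PFRun X N L) : ℝ := ∑ i, v.1.2.1 i * h (v.1.1 i)

/-! ### Coupled PIMH

The algorithm is driven by particle filter outputs `ξ 0, ξ 1, …` and uniforms `u 1, u 2, …`:
`ξ 0` is the initial state of the first chain, and `ξ n`, `u n` are the proposal and the uniform
used in iteration `n ≥ 1`. -/

/-- The acceptance probability `α(p, p*) = 1 ∧ p* / p`. -/
def accProb (p pstar : ℝ) : ℝ := min 1 (pstar / p)

/-- The first chain: `(X_{1:T}^{(n)}, p_N^{(n)})`, with the whole particle system. -/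
def chain (ξ : ℕ → PFRun X N L) (u : ℕ → ℝ) : ℕ → PFRun X N L
  | 0 => ξ 0
  | n + 1 => if u (n + 1) ≤ accProb (chain ξ u n).pN (ξ (n + 1)).pN then ξ (n + 1)
      else chain ξ u n

/-- The second chain: its `n`-th state is set in iteration `n + 1`. In iteration `1` the
proposal is always accepted. -/
def lagChain (ξ : ℕ → PFRun X N L) (u : ℕ → ℝ) : ℕ → PFRun X N L
  | 0 => ξ 1
  | n + 1 => if u (n + 2) ≤ accProb (lagChain ξ u n).pN (ξ (n + 2)).pN then ξ (n + 2)
      else lagChain ξ u n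

/-- The acceptance probability of the first chain in iteration `n ≥ 1`. -/
def acc (ξ : ℕ → PFRun X N L) (u : ℕ → ℝ) (n : ℕ) : ℝ :=
  accProb (chain ξ u (n - 1)).pN (ξ n).pN

/-- The acceptance probability of the second chain in iteration `n ≥ 1`, equal to `1` for
`n = 1`. -/
def lagAcc (ξ : ℕ → PFRun X N L) (u : ℕ → ℝ) (n : ℕ) : ℝ :=
  if n ≤ 1 then 1 else accProb (lagChain ξ u (n - 2)).pN (ξ n).pN

/-- The meeting time `τ`: the first iteration whose proposal is accepted by both chains, and `∞`
if there is none. -/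
def meetingTime (ξ : ℕ → PFRun X N L) (u : ℕ → ℝ) : ℕ∞ :=
  ⨅ n ∈ {n : ℕ | 1 ≤ n ∧ u n ≤ min (acc ξ u n) (lagAcc ξ u n)}, (n : ℕ∞)

/-- The time-averaged estimator formed from test function values `φ l` along the first chain and
`φ' l` along the second chain,
`(m-k+1)⁻¹ ∑_{l=k}^m φ_l + ∑_{l=k+1}^{τ-1} min(1, (l-k)/(m-k+1)) (φ_l - φ'_{l-1})`. -/
def timeAveraged (k m : ℕ) (τ : ℕ∞) (φ φ' : ℕ → ℝ) : ℝ :=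
  1 / ((m : ℝ) - k + 1) * ∑ l ∈ Finset.Icc k m, φ l +
    ∑ l ∈ Finset.Ico (k + 1) τ.toNat,
      min 1 (((l : ℝ) - k) / ((m : ℝ) - k + 1)) * (φ l - φ' (l - 1))

/-- The estimator `H_{k:m}` returned by coupled PIMH. -/
def estimator (h : (Fin (L + 1) → X) → ℝ) (k m : ℕ) (ξ : ℕ → PFRun X N L) (u : ℕ → ℝ) : ℝ :=
  timeAveraged k m (meetingTime ξ u) (fun l => h (chain ξ u l).path)
    (fun l => h (lagChain ξ u l).path)

/-- The Rao-Blackwellised estimator `H̄_{k:m}`: `h(X_{1:T})` is replaced by `π_N(h)`. -/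
def rbEstimator (h : (Fin (L + 1) → X) → ℝ) (k m : ℕ) (ξ : ℕ → PFRun X N L) (u : ℕ → ℝ) : ℝ :=
  timeAveraged k m (meetingTime ξ u) (fun l => (chain ξ u l).piN h)
    (fun l => (lagChain ξ u l).piN h)

/-- The cost of coupled PIMH: the number of calls to the particle filter, namely one for the
initialisation and one in each of the iterations `1, …, max(m, τ)`. -/
def cost (m : ℕ) (ξ : ℕ → PFRun X N L) (u : ℕ → ℝ) : ℕ∞ := 1 + max (m : ℕ∞) (meetingTime ξ u)

end Run

/-- `sup_n E|Z_n|^{2+η}` is finite for some `η > 0`. -/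
def UniformMomentBound {Ω : Type*} [MeasurableSpace Ω] (P : Measure Ω) (Z : ℕ → Ω → ℝ) : Prop :=
  ∃ η : ℝ, 0 < η ∧ ∃ D : ℝ, ∀ n,
    ∫⁻ ω, ENNReal.ofReal (|Z n ω| ^ (2 + η)) ∂P < ENNReal.ofReal D

/-- `H` is an unbiased estimator of `θ` with finite variance. -/
def UnbiasedFiniteVariance {Ω : Type*} [MeasurableSpace Ω] (P : Measure Ω) (H : Ω → ℝ) (θ : ℝ) :
    Prop :=
  MemLp H 2 P ∧ ∫ ω, H ω ∂P = θ

end CoupledPIMH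

end

/-!
The coupled chain is an independent Metropolis–Hastings chain on outputs of the particle filter: the
proposal law is `Λ = pfRunLaw`, and the acceptance ratio is the ratio of the likelihood estimates
`p_N`. Hence its invariant law is `Λ` reweighted by `p_N` (`mhPush_target`). The particle filter is
unbiased, `E[p_N π_N(Φ)] = ∫ Φ(x) p(x, y) dx` (`lintegral_unnormalisedEstimate`, by induction on
time), so that under this target the sampled path, and also the average `π_N`, have the smoothing
distribution as mean measure (`map_path_target`, `integral_piN_target`).

Bounded weights give a bound `p_N ≤ B`, and positive weights give `p_N > 0`, almost surely
(`ae_regularState`). Since `min(1, p*/p) ≥ p*/B`, every transition dominates `ε` times the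
normalised target, where `ε = E[p*]/B > 0` (`smul_target_le_mhPush`, `minAccept`). This has two consequences.

* The law after `n` iterations is a multiple of the target plus a remainder of mass `(1 - ε)^n`
  (`IIDInputs.exists_map_chain_eq`), which with bounded moments along the chain yields integrability
  under the target and convergence of the means (`IIDInputs.tendsto_integral_chain`).
* Whenever `u_n ≤ p*/B`, both chains accept. These events are independent of probability `ε`, so
  `P(τ > l) ≤ (1 - ε)^l` (`IIDInputs.measure_rejectSet`, `IIDInputs.ae_mem_rejectSet`), and the
  expected cost is finite.

The chains agree from the meeting time on, so the correction term of the estimator is the full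
series of weighted increments `φ_l - φ'_{l-1}`. By Hölder's inequality the moment of order `2 + η` and the
geometric tail of `τ` make the `L²` norms of the increments decay geometrically; so the series
converges in `L²` and may be integrated term by term. As the second chain is the first one with
shifted inputs, both have the same one-dimensional laws (`IIDInputs.map_lagChain`), and the series
of means telescopes to the limit of the means minus the bias of the ergodic average
(`average_add_eq_of_tendsto`).
-/

namespace CoupledPIMH

/-! ### Measurability of the particle filter transition -/

/-- A finite product of probability measures depends measurably on its factors. -/
lemma measurable_measure_pi {α ι E : Type*} [Fintype ι] [MeasurableSpace α] [MeasurableSpace E]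
    (κ : α → ι → Measure E) [∀ a i, IsProbabilityMeasure (κ a i)]
    (hκ : ∀ i, Measurable fun a => κ a i) : Measurable fun a => Measure.pi (κ a) := by
  refine Measurable.measure_of_isPiSystem_of_isProbabilityMeasure (μ := fun a => Measure.pi (κ a))
    generateFrom_pi.symm isPiSystem_pi ?_
  rintro _ ⟨s, hs, rfl⟩
  simp only [Measure.pi_pi]
  exact Finset.measurable_prod _ fun i _ => (Measure.measurable_coe (hs i trivial)).comp (hκ i)

section Density

variable {E A : Type*} [MeasurableSpace E] [MeasurableSpace A] {ν : Measure E}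

lemma IsDensity.isProbabilityMeasure {p : E → ℝ} (hp : IsDensity ν p) :
    IsProbabilityMeasure (densityMeasure ν p) :=
  ⟨by rw [densityMeasure, withDensity_apply _ .univ, Measure.restrict_univ, hp.2.2]⟩

lemma lintegral_densityMeasure {p : E → ℝ} (hp : Measurable p) {F : E → ℝ≥0∞}
    (hF : Measurable F) :
    ∫⁻ x, F x ∂(densityMeasure ν p) = ∫⁻ x, ENNReal.ofReal (p x) * F x ∂ν := by
  rw [densityMeasure, lintegral_withDensity_eq_lintegral_mul _ hp.ennreal_ofReal hF]
  rfl

lemma ae_densityMeasure_ne_zero {p : E → ℝ} (hp : Measurable p) :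
    ∀ᵐ x ∂(densityMeasure ν p), p x ≠ 0 := by
  rw [densityMeasure, ae_withDensity_iff hp.ennreal_ofReal]
  refine Filter.Eventually.of_forall fun x hx h0 => hx (by simp [h0])

lemma measurable_densityMeasure [SFinite ν] {k : A → E → ℝ} (hk : IsCondDensity ν k) :
    Measurable fun x => densityMeasure ν (k x) := by
  refine Measure.measurable_of_measurable_coe _ fun s hs => ?_
  simp only [densityMeasure, withDensity_apply _ hs]
  exact Measurable.lintegral_prod_right (f := fun x e => ENNReal.ofReal (k x e))
    hk.1.ennreal_ofReal

end Density

section ParticleFilter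

variable {X Y : Type*} [MeasurableSpace X] [MeasurableSpace Y] {ν : Measure X} {ρ : Measure Y}
  (M : StateSpaceModel ν ρ) (Q : Proposal ν) (y : ℕ → Y)

lemma measurable_weight1 : Measurable (weight1 M Q y) :=
  ((M.g_density.1.comp (measurable_id.prodMk measurable_const)).mul M.mu_density.1).div
    Q.q1_density.1

lemma measurable_weight (t : ℕ) (ht : 2 ≤ t) : Measurable (Function.uncurry (weight M Q y t)) :=
  ((M.g_density.1.comp (measurable_snd.prodMk measurable_const)).mul M.f_density.1).div
    (Q.q_density t ht).1

lemma weight1_nonneg (x : X) : 0 ≤ weight1 M Q y x :=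
  div_nonneg (mul_nonneg ((M.g_density.2 x).2.1 _) (M.mu_density.2.1 x)) (Q.q1_density.2.1 x)

lemma weight_nonneg (t : ℕ) (ht : 2 ≤ t) (x x' : X) : 0 ≤ weight M Q y t x x' :=
  div_nonneg (mul_nonneg ((M.g_density.2 x').2.1 _) ((M.f_density.2 x).2.1 x'))
    (((Q.q_density t ht).2 x).2.1 x')

lemma measurable_avgWeight {N : ℕ} : Measurable (avgWeight (N := N)) := by
  unfold avgWeight; fun_prop

lemma measurable_normWeights {N : ℕ} : Measurable (normWeights (N := N)) := by
  unfold normWeights; fun_prop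

lemma measurable_initState {N : ℕ} : Measurable (initState M Q y (N := N)) := by
  have h1 : Measurable fun (x : Fin N → X) i => weight1 M Q y (x i) :=
    measurable_pi_lambda _ fun i => (measurable_weight1 M Q y).comp (measurable_pi_apply i)
  refine Measurable.prodMk ?_
    ((measurable_normWeights.comp h1).prodMk (measurable_avgWeight.comp h1))
  fun_prop

lemma measurable_snoc {t : ℕ} :
    Measurable fun p : (Fin (t + 1) → X) × X => Fin.snoc (α := fun _ => X) p.1 p.2 := by
  refine measurable_pi_lambda _ fun j => ?_
  refine Fin.lastCases ?_ (fun j => ?_) j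
  · simpa using measurable_snd
  · simp only [Fin.snoc_castSucc]
    fun_prop

lemma measurable_nextState {N t : ℕ} (a : Fin N → Fin N) :
    Measurable fun p : PFState X N t × (Fin N → X) => nextState M Q y p.1 a p.2 := by
  have h1 : Measurable fun (p : PFState X N t × (Fin N → X)) i =>
      weight M Q y (t + 2) (p.1.1 (a i) (Fin.last t)) (p.2 i) :=
    measurable_pi_lambda _ fun i => (measurable_weight M Q y (t + 2) (by omega)).comp
      (f := fun p : PFState X N t × (Fin N → X) => (p.1.1 (a i) (Fin.last t), p.2 i))
      (by fun_prop)
  refine Measurable.prodMk ?_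
    ((measurable_normWeights.comp h1).prodMk
      ((show Measurable fun p : PFState X N t × (Fin N → X) => p.1.2.2 by fun_prop).mul
        (measurable_avgWeight.comp h1)))
  refine measurable_pi_lambda _ fun i => measurable_snoc.comp
    (f := fun p : PFState X N t × (Fin N → X) => (p.1.1 (a i), p.2 i)) (by fun_prop)

variable {N : ℕ} (r : Kernel (Fin N → ℝ) (Fin N → Fin N))

/-- The joint law of the new particles, given the state `s` and the ancestors `a`. -/
noncomputable def moveMeasure {t : ℕ} (s : PFState X N t) (a : Fin N → Fin N) :
    Measure (Fin N → X) :=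
  Measure.pi fun i : Fin N => densityMeasure ν (Q.q (t + 2) (s.1 (a i) (Fin.last t)))

instance isProbabilityMeasure_density {t : ℕ} (x : X) :
    IsProbabilityMeasure (densityMeasure ν (Q.q (t + 2) x)) :=
  ((Q.q_density (t + 2) (by omega)).2 x).isProbabilityMeasure

instance {t : ℕ} (s : PFState X N t) (a : Fin N → Fin N) :
    IsProbabilityMeasure (moveMeasure Q s a) := by
  unfold moveMeasure; infer_instance

/-- The law of the next state of the particle filter, given the state `s`. -/
noncomputable def stepMeasure {t : ℕ} (s : PFState X N t) : Measure (PFState X N (t + 1)) :=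
  (r s.2.1).bind fun a => (moveMeasure Q s a).map (nextState M Q y s a)

lemma pfLaw_succ (t : ℕ) :
    pfLaw M Q y r (t + 1) = (pfLaw M Q y r t).bind (stepMeasure M Q y r) := rfl

lemma lintegral_stepMeasure {t : ℕ} (s : PFState X N t)
    {φ : PFState X N (t + 1) → ℝ≥0∞} (hφ : Measurable φ) :
    ∫⁻ s', φ s' ∂(stepMeasure M Q y r s) =
      ∑ a, (∫⁻ x, φ (nextState M Q y s a x) ∂(moveMeasure Q s a)) * r s.2.1 {a} := by
  rw [stepMeasure, Measure.lintegral_bind (Measurable.of_discrete).aemeasurable hφ.aemeasurable,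
    lintegral_fintype]
  refine Finset.sum_congr rfl fun a _ => ?_
  rw [lintegral_map hφ]
  exact (measurable_nextState M Q y a).comp (measurable_const.prodMk measurable_id)

variable [SFinite ν]

lemma measurable_moveMeasure {t : ℕ} (a : Fin N → Fin N) :
    Measurable fun s : PFState X N t => moveMeasure Q s a :=
  measurable_measure_pi (fun (s : PFState X N t) (i : Fin N) =>
    densityMeasure ν (Q.q (t + 2) (s.1 (a i) (Fin.last t)))) fun i =>
    (measurable_densityMeasure (Q.q_density (t + 2) (by omega))).comp
      (g := fun x => densityMeasure ν (Q.q (t + 2) x))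
      (f := fun s : PFState X N t => s.1 (a i) (Fin.last t)) (by fun_prop)

lemma measurable_lintegral_moveMeasure {t : ℕ} (a : Fin N → Fin N)
    {φ : PFState X N (t + 1) → ℝ≥0∞} (hφ : Measurable φ) :
    Measurable fun s : PFState X N t => ∫⁻ x, φ (nextState M Q y s a x) ∂(moveMeasure Q s a) := by
  let κ : Kernel (PFState X N t) (Fin N → X) := ⟨fun s => moveMeasure Q s a,
    measurable_moveMeasure Q a⟩
  have : IsMarkovKernel κ := ⟨fun s => inferInstanceAs (IsProbabilityMeasure (moveMeasure Q s a))⟩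
  exact Measurable.lintegral_kernel_prod_right (κ := κ)
    (f := fun s x => φ (nextState M Q y s a x)) (hφ.comp (measurable_nextState M Q y a))

lemma measurable_stepMeasure {t : ℕ} :
    Measurable fun s : PFState X N t => stepMeasure M Q y r s := by
  refine Measure.measurable_of_measurable_coe _ fun A hA => ?_
  have h1 : Measurable (A.indicator (1 : PFState X N (t + 1) → ℝ≥0∞)) :=
    measurable_one.indicator hA
  simp only [← lintegral_indicator_one hA, lintegral_stepMeasure M Q y r _ h1]
  refine Finset.measurable_sum _ fun a _ =>
    (measurable_lintegral_moveMeasure M Q y a h1).mul ?_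
  exact (r.measurable_coe (measurableSet_singleton a)).comp (by fun_prop)

lemma lintegral_pfLaw_succ (t : ℕ) {φ : PFState X N (t + 1) → ℝ≥0∞} (hφ : Measurable φ) :
    ∫⁻ s, φ s ∂(pfLaw M Q y r (t + 1)) = ∫⁻ s, ∑ a,
      (∫⁻ x, φ (nextState M Q y s a x) ∂(moveMeasure Q s a)) * r s.2.1 {a}
        ∂(pfLaw M Q y r t) := by
  rw [pfLaw_succ, Measure.lintegral_bind (measurable_stepMeasure M Q y r).aemeasurable
    hφ.aemeasurable]
  exact lintegral_congr fun s => lintegral_stepMeasure M Q y r s hφ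

end ParticleFilter

/-! ### Unbiasedness of the particle filter -/

section Weights

variable {N : ℕ} {v : Fin N → ℝ}

lemma normWeights_mem_stdSimplex (hN : 1 ≤ N) (hv : ∀ i, 0 < v i) :
    normWeights v ∈ stdSimplex ℝ (Fin N) := by
  have : Nonempty (Fin N) := ⟨⟨0, hN⟩⟩
  have hs : 0 < ∑ j, v j := Finset.sum_pos (fun i _ => hv i) Finset.univ_nonempty
  refine ⟨fun i => div_nonneg (hv i).le hs.le, ?_⟩
  simp only [normWeights]
  rw [← Finset.sum_div, div_self hs.ne']

lemma avgWeight_pos (hN : 1 ≤ N) (hv : ∀ i, 0 < v i) : 0 < avgWeight v := by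
  have : Nonempty (Fin N) := ⟨⟨0, hN⟩⟩
  have hs : 0 < ∑ j, v j := Finset.sum_pos (fun i _ => hv i) Finset.univ_nonempty
  have : (0 : ℝ) < N := by exact_mod_cast hN
  unfold avgWeight; positivity

lemma avgWeight_le (hN : 1 ≤ N) {c : ℝ} (hv : ∀ i, v i ≤ c) : avgWeight v ≤ c := by
  have h0 : (0 : ℝ) < N := by exact_mod_cast hN
  have h1 : ∑ i, v i ≤ N * c := by
    simpa using Finset.sum_le_sum fun (i : Fin N) (_ : i ∈ Finset.univ) => hv i
  rw [avgWeight, one_div, inv_mul_le_iff₀ h0]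
  exact h1

lemma avgWeight_nonneg (hv : ∀ i, 0 ≤ v i) : 0 ≤ avgWeight v :=
  mul_nonneg (by positivity) (Finset.sum_nonneg fun i _ => hv i)

lemma normWeights_nonneg (hv : ∀ i, 0 ≤ v i) (i : Fin N) : 0 ≤ normWeights v i :=
  div_nonneg (hv i) (Finset.sum_nonneg fun j _ => hv j)

/-- The likelihood factor cancels the normalisation of the weights. -/
lemma avgWeight_mul_normWeights (hv : ∀ i, 0 ≤ v i) (i : Fin N) :
    avgWeight v * normWeights v i = (N : ℝ)⁻¹ * v i := by
  rcases (Finset.sum_nonneg fun j (_ : j ∈ Finset.univ) => hv j).eq_or_lt with h0 | h0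
  -- if all weights vanish, then both sides are zero
  · have := (Finset.sum_eq_zero_iff_of_nonneg fun j _ => hv j).1 h0.symm i (Finset.mem_univ i)
    simp [avgWeight, this, ← h0]
  · unfold avgWeight normWeights
    field_simp

lemma ofReal_avgWeight_mul_normWeights (hv : ∀ i, 0 ≤ v i) (i : Fin N) :
    ENNReal.ofReal (avgWeight v) * ENNReal.ofReal (normWeights v i) =
      (N : ℝ≥0∞)⁻¹ * ENNReal.ofReal (v i) := by
  have hN : (0 : ℝ) < N := by
    exact_mod_cast (Fin.pos i)
  rw [← ENNReal.ofReal_mul' (normWeights_nonneg hv i),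
    avgWeight_mul_normWeights hv, ENNReal.ofReal_mul (by positivity), ENNReal.ofReal_inv_of_pos hN,
    ENNReal.ofReal_natCast]

end Weights

section ParticleFilter

variable {X Y : Type*} [MeasurableSpace X] [MeasurableSpace Y] {ν : Measure X} {ρ : Measure Y}
  (M : StateSpaceModel ν ρ) (Q : Proposal ν) (y : ℕ → Y) {N : ℕ}
  (r : Kernel (Fin N → ℝ) (Fin N → Fin N))

/-- The state of the particle filter is regular: the likelihood estimate is positive and at most
`B`, and the weights are normalised. -/
def RegularState (B : ℝ) {t : ℕ} (s : PFState X N t) : Prop :=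
  0 < s.2.2 ∧ s.2.2 ≤ B ∧ s.2.1 ∈ stdSimplex ℝ (Fin N)

lemma measurableSet_regularState (B : ℝ) {t : ℕ} :
    MeasurableSet {s : PFState X N t | RegularState B s} := by
  have h1 : Measurable fun s : PFState X N t => s.2.2 := by fun_prop
  have h2 : Measurable fun s : PFState X N t => s.2.1 := by fun_prop
  exact (measurableSet_lt measurable_const h1).inter ((measurableSet_le h1 measurable_const).inter
    (h2 (isCompact_stdSimplex ℝ (Fin N)).isClosed.measurableSet))

lemma ae_pi_of_forall_ae {ι E : Type*} [Fintype ι] [MeasurableSpace E] {μ : ι → Measure E}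
    [∀ i, IsProbabilityMeasure (μ i)] {p : ι → E → Prop} (hp : ∀ i, ∀ᵐ x ∂(μ i), p i x) :
    ∀ᵐ x ∂(Measure.pi μ), ∀ i, p i (x i) := by
  rw [ae_all_iff]
  exact fun i => Measure.tendsto_eval_ae_ae.eventually (hp i)

lemma measurable_jointDensity (L : ℕ) : Measurable (jointDensity M y L) := by
  have hmu := M.mu_density.1
  have hf := M.f_density.1
  have hg (y : Y) : Measurable fun x => M.g x y :=
    M.g_density.1.comp (f := fun x => (x, y)) (by fun_prop)
  refine ((hmu.comp (measurable_pi_apply 0)).mul ((hg _).comp (measurable_pi_apply 0))).mul ?_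
  refine Finset.measurable_prod _ fun i _ => ?_
  exact (hf.comp (f := fun x : Fin (L + 1) → X => (x i.castSucc, x i.succ)) (by fun_prop)).mul
    ((hg _).comp (measurable_pi_apply i.succ))

lemma jointDensity_nonneg (L : ℕ) (x : Fin (L + 1) → X) : 0 ≤ jointDensity M y L x :=
  mul_nonneg (mul_nonneg (M.mu_density.2.1 _) ((M.g_density.2 _).2.1 _))
    (Finset.prod_nonneg fun _ _ => mul_nonneg ((M.f_density.2 _).2.1 _) ((M.g_density.2 _).2.1 _))

lemma jointDensity_snoc (L : ℕ) (x : Fin (L + 1) → X) (x' : X) :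
    jointDensity M y (L + 1) (Fin.snoc (α := fun _ => X) x x') =
      jointDensity M y L x * (M.g x' (y (L + 2)) * M.f (x (Fin.last L)) x') := by
  have h0 : Fin.snoc (α := fun _ => X) x x' 0 = x 0 := Fin.snoc_castSucc (i := 0) ..
  simp only [jointDensity, Fin.prod_univ_castSucc, h0, Fin.succ_last, Fin.snoc_last,
    Fin.snoc_castSucc, Fin.val_last, Fin.val_castSucc, ← Fin.castSucc_succ]
  ring

/-- Integrating a function of a path after one more transition of the model: the unnormalised
conditional expectation of `Φ(x_{1:t+2})` given `x_{1:t+1} = z`. -/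
noncomputable def propagate {t : ℕ} (Φ : (Fin (t + 2) → X) → ℝ≥0∞) (z : Fin (t + 1) → X) : ℝ≥0∞ :=
  ∫⁻ x', ENNReal.ofReal (M.g x' (y (t + 2)) * M.f (z (Fin.last t)) x') *
    Φ (Fin.snoc (α := fun _ => X) z x') ∂ν

lemma measurable_propagate_integrand {t : ℕ} {Φ : (Fin (t + 2) → X) → ℝ≥0∞} (hΦ : Measurable Φ) :
    Measurable fun p : (Fin (t + 1) → X) × X =>
      ENNReal.ofReal (M.g p.2 (y (t + 2)) * M.f (p.1 (Fin.last t)) p.2) *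
        Φ (Fin.snoc (α := fun _ => X) p.1 p.2) := by
  refine Measurable.mul (Measurable.ennreal_ofReal (Measurable.mul ?_ ?_)) (hΦ.comp measurable_snoc)
  · exact M.g_density.1.comp (f := fun p : (Fin (t + 1) → X) × X => (p.2, y (t + 2)))
      (by fun_prop)
  · exact M.f_density.1.comp (f := fun p : (Fin (t + 1) → X) × X => (p.1 (Fin.last t), p.2))
      (by fun_prop)

/-- Reweighting a draw from the proposal by the incremental weight integrates against the model's
transition instead. -/
lemma lintegral_weight_mul {T t : ℕ} (hpos : WeightsPositive M Q y T) (ht : t + 2 ≤ T)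
    {Φ : (Fin (t + 2) → X) → ℝ≥0∞} (hΦ : Measurable Φ) (z : Fin (t + 1) → X) :
    ∫⁻ x', ENNReal.ofReal (weight M Q y (t + 2) (z (Fin.last t)) x') *
      Φ (Fin.snoc (α := fun _ => X) z x')
        ∂(densityMeasure ν (Q.q (t + 2) (z (Fin.last t)))) = propagate M y Φ z := by
  have hq := (Q.q_density (t + 2) (by omega)).2 (z (Fin.last t))
  rw [lintegral_densityMeasure hq.1]
  · refine lintegral_congr fun x => ?_
    rw [← mul_assoc, ← ENNReal.ofReal_mul (hq.2.1 x)]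
    congr 2
    by_cases h0 : Q.q (t + 2) (z (Fin.last t)) x = 0
    · rw [((hpos.2 (t + 2) (by omega) ht _ _).2 h0), h0, zero_mul]
    · rw [weight, mul_div_cancel₀ _ h0]
  · refine Measurable.mul (Measurable.ennreal_ofReal ?_) ?_
    · exact (measurable_weight M Q y (t + 2) (by omega)).comp
        (f := fun x => (z (Fin.last t), x)) (by fun_prop)
    · exact hΦ.comp (measurable_snoc.comp (f := fun x => (z, x)) (by fun_prop))

/-- Unbiased resampling preserves weighted sums over the particles in mean. -/
lemma sum_resampling (hr : UnbiasedResampling r) {W : Fin N → ℝ} (hW : W ∈ stdSimplex ℝ (Fin N))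
    (ψ : Fin N → ℝ≥0∞) :
    ∑ a, (∑ i, ψ (a i)) * r W {a} = N * ∑ k, ENNReal.ofReal (W k) * ψ k := by
  have h1 : ∀ i, ∑ a, ψ (a i) * r W {a} = ∑ k, ψ k * r W {a | a i = k} := fun i => by
    have h2 : ∀ k, r W {a | a i = k} = ∑ a, if a i = k then r W {a} else 0 := fun k => by
      rw [← Finset.sum_filter, sum_measure_singleton]
      simp
    simp only [h2, Finset.mul_sum, mul_ite, mul_zero]
    rw [Finset.sum_comm]
    simp
  simp only [Finset.sum_mul]
  rw [Finset.sum_comm]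
  simp only [h1]
  rw [Finset.sum_comm, Finset.mul_sum]
  refine Finset.sum_congr rfl fun k _ => ?_
  rw [← Finset.mul_sum, hr W hW k]
  ring

lemma lintegral_jointMeasure_zero {Φ : (Fin 1 → X) → ℝ≥0∞} (hΦ : Measurable Φ) :
    ∫⁻ x, Φ x ∂(jointMeasure M y 0) =
      ∫⁻ x, ENNReal.ofReal (M.g x (y 1) * M.mu x) * Φ (fun _ => x) ∂ν := by
  rw [jointMeasure, lintegral_densityMeasure (measurable_jointDensity M y 0) hΦ]
  refine ((measurePreserving_funUnique ν (Fin 1)).symm.lintegral_comp_emb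
    (MeasurableEquiv.measurableEmbedding _) _).symm.trans ?_
  refine lintegral_congr fun x => ?_
  have : (MeasurableEquiv.funUnique (Fin 1) X).symm x = fun _ => x := by
    ext i; simp [MeasurableEquiv.funUnique]
  rw [this]
  simp [jointDensity, mul_comm]

/-- The particle approximation of the unnormalised smoothing measure, `p_N · π_N(Φ)`. -/
noncomputable def unnormalisedEstimate {t : ℕ} (Φ : (Fin (t + 1) → X) → ℝ≥0∞)
    (s : PFState X N t) : ℝ≥0∞ :=
  ENNReal.ofReal s.2.2 * ∑ i, ENNReal.ofReal (s.2.1 i) * Φ (s.1 i)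

lemma measurable_unnormalisedEstimate {t : ℕ} {Φ : (Fin (t + 1) → X) → ℝ≥0∞} (hΦ : Measurable Φ) :
    Measurable (unnormalisedEstimate (N := N) Φ) := by
  unfold unnormalisedEstimate
  fun_prop

lemma unnormalisedEstimate_nextState {t : ℕ} (Φ : (Fin (t + 2) → X) → ℝ≥0∞) (s : PFState X N t)
    (a : Fin N → Fin N) (x : Fin N → X) :
    unnormalisedEstimate Φ (nextState M Q y s a x) =
      ENNReal.ofReal s.2.2 * ((N : ℝ≥0∞)⁻¹ * ∑ i,
        ENNReal.ofReal (weight M Q y (t + 2) (s.1 (a i) (Fin.last t)) (x i)) *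
          Φ (Fin.snoc (α := fun _ => X) (s.1 (a i)) (x i))) := by
  have hv : ∀ i, 0 ≤ weight M Q y (t + 2) (s.1 (a i) (Fin.last t)) (x i) :=
    fun i => weight_nonneg M Q y (t + 2) (by omega) _ _
  simp only [unnormalisedEstimate, nextState]
  rw [ENNReal.ofReal_mul' (avgWeight_nonneg hv), mul_assoc]
  congr 1
  rw [Finset.mul_sum, Finset.mul_sum]
  refine Finset.sum_congr rfl fun i _ => ?_
  rw [← mul_assoc, ofReal_avgWeight_mul_normWeights hv, mul_assoc]

lemma lintegral_unnormalisedEstimate_nextState {T t : ℕ} (hpos : WeightsPositive M Q y T)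
    (ht : t + 2 ≤ T) {Φ : (Fin (t + 2) → X) → ℝ≥0∞} (hΦ : Measurable Φ) (s : PFState X N t)
    (a : Fin N → Fin N) :
    ∫⁻ x, unnormalisedEstimate Φ (nextState M Q y s a x) ∂(moveMeasure Q s a) =
      ENNReal.ofReal s.2.2 * ((N : ℝ≥0∞)⁻¹ * ∑ i, propagate M y Φ (s.1 (a i))) := by
  have hm : ∀ i, Measurable fun x' =>
      ENNReal.ofReal (weight M Q y (t + 2) (s.1 (a i) (Fin.last t)) x') *
          Φ (Fin.snoc (α := fun _ => X) (s.1 (a i)) x') := fun i => by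
    refine Measurable.mul (Measurable.ennreal_ofReal ?_) ?_
    · exact (measurable_weight M Q y (t + 2) (by omega)).comp
        (f := fun x => (s.1 (a i) (Fin.last t), x)) (by fun_prop)
    · exact hΦ.comp (measurable_snoc.comp (f := fun x => (s.1 (a i), x)) (by fun_prop))
  simp only [unnormalisedEstimate_nextState]
  have hm' := fun i => (hm i).comp (measurable_pi_apply (X := fun _ : Fin N => X) i)
  simp only [Function.comp_def] at hm'
  rw [lintegral_const_mul _ ((Finset.measurable_sum _ fun i _ => hm' i).const_mul _),
    lintegral_const_mul _ (Finset.measurable_sum _ fun i _ => hm' i),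
    lintegral_finsetSum _ fun i _ => hm' i]
  congr 2
  refine Finset.sum_congr rfl fun i _ => ?_
  rw [← lintegral_weight_mul M Q y hpos ht hΦ (s.1 (a i))]
  exact (measurePreserving_eval (fun i : Fin N =>
    densityMeasure ν (Q.q (t + 2) (s.1 (a i) (Fin.last t)))) i).lintegral_comp (hm i)

variable [SFinite ν]

lemma ae_pfLaw_succ {t : ℕ} {p : PFState X N (t + 1) → Prop} (hp : MeasurableSet {s | p s})
    (h : ∀ᵐ s ∂(pfLaw M Q y r t), ∀ a, ∀ᵐ x ∂(moveMeasure Q s a), p (nextState M Q y s a x)) :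
    ∀ᵐ s ∂(pfLaw M Q y r (t + 1)), p s := by
  have h1 : Measurable ({s | p s}ᶜ.indicator (1 : PFState X N (t + 1) → ℝ≥0∞)) :=
    measurable_one.indicator hp.compl
  rw [ae_iff]
  change (pfLaw M Q y r (t + 1)) {s | p s}ᶜ = 0
  rw [← lintegral_indicator_one hp.compl, lintegral_pfLaw_succ _ _ _ _ _ h1]
  refine (lintegral_congr_ae ?_).trans lintegral_zero
  filter_upwards [h] with s hs
  refine Finset.sum_eq_zero fun a _ => ?_
  rw [(lintegral_congr_ae ?_).trans lintegral_zero, zero_mul]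
  filter_upwards [hs a] with x hx
  simp [hx]

/-- Positive and bounded incremental weights keep the particle filter regular: almost surely it
never dies out, and its likelihood estimates are bounded. -/
lemma ae_regularState (hN : 1 ≤ N) {T : ℕ} (hpos : WeightsPositive M Q y T)
    (hbdd : WeightsBounded M Q y T) (t : ℕ) (ht : t + 1 ≤ T) :
    ∃ B : ℝ, ∀ᵐ s ∂(pfLaw M Q y r t), RegularState B s := by
  obtain ⟨w, hw1, hw⟩ := hbdd
  induction t with
  | zero =>
    have : IsProbabilityMeasure (densityMeasure ν Q.q1) := Q.q1_density.isProbabilityMeasure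
    refine ⟨w 1, ?_⟩
    simp only [pfLaw]
    rw [ae_map_iff (measurable_initState M Q y).aemeasurable (measurableSet_regularState _)]
    filter_upwards [ae_pi_of_forall_ae (μ := fun _ : Fin N => densityMeasure ν Q.q1)
      fun _ => ae_densityMeasure_ne_zero Q.q1_density.1] with x hx
    have hv : ∀ i, 0 < weight1 M Q y (x i) := fun i => (hpos.1 (x i)).1 (hx i)
    exact ⟨avgWeight_pos hN hv, avgWeight_le hN fun i => hw1 (x i),
      normWeights_mem_stdSimplex hN hv⟩
  | succ t ih =>
    obtain ⟨B, hB⟩ := ih (by omega)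
    refine ⟨B * w (t + 2), ?_⟩
    refine ae_pfLaw_succ M Q y r (measurableSet_regularState _) ?_
    filter_upwards [hB] with s hs a
    filter_upwards [ae_pi_of_forall_ae
      (μ := fun i => densityMeasure ν (Q.q (t + 2) (s.1 (a i) (Fin.last t))))
      fun i => ae_densityMeasure_ne_zero ((Q.q_density (t + 2) (by omega)).2 _).1] with x hx
    have hv : ∀ i, 0 < weight M Q y (t + 2) (s.1 (a i) (Fin.last t)) (x i) :=
      fun i => (hpos.2 (t + 2) (by omega) (by omega) _ _).1 (hx i)
    have h1 := avgWeight_pos hN hv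
    have h2 := avgWeight_le hN fun i => hw (t + 2) (by omega) (by omega)
      (s.1 (a i) (Fin.last t)) (x i)
    exact ⟨mul_pos hs.1 h1, mul_le_mul hs.2.1 h2 h1.le (hs.1.le.trans hs.2.1),
      normWeights_mem_stdSimplex hN hv⟩

lemma measurable_propagate {t : ℕ} {Φ : (Fin (t + 2) → X) → ℝ≥0∞} (hΦ : Measurable Φ) :
    Measurable (propagate (ν := ν) M y Φ) :=
  (measurable_propagate_integrand M y hΦ).lintegral_prod_right'

end ParticleFilter

section SigmaFinite

variable {X Y : Type*} [MeasurableSpace X] [MeasurableSpace Y] {ν : Measure X} {ρ : Measure Y}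
  [SigmaFinite ν] (M : StateSpaceModel ν ρ) (Q : Proposal ν) (y : ℕ → Y) {N : ℕ}
  (r : Kernel (Fin N → ℝ) (Fin N → Fin N))

/-- The unnormalised smoothing measures are linked by the transition of the model. -/
lemma lintegral_jointMeasure_succ (t : ℕ) {Φ : (Fin (t + 2) → X) → ℝ≥0∞} (hΦ : Measurable Φ) :
    ∫⁻ x, Φ x ∂(jointMeasure M y (t + 1)) = ∫⁻ z, propagate M y Φ z ∂(jointMeasure M y t) := by
  rw [jointMeasure, lintegral_densityMeasure (measurable_jointDensity M y (t + 1)) hΦ,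
    jointMeasure, lintegral_densityMeasure (measurable_jointDensity M y t)
      (measurable_propagate M y hΦ)]
  rw [← (measurePreserving_piFinSuccAbove (fun _ : Fin (t + 2) => ν)
    (Fin.last (t + 1))).symm.lintegral_comp_emb (MeasurableEquiv.measurableEmbedding _)]
  have hsn : ∀ p : X × (Fin (t + 1) → X),
      (MeasurableEquiv.piFinSuccAbove (fun _ => X) (Fin.last (t + 1))).symm p =
        Fin.snoc (α := fun _ => X) p.2 p.1 := fun p => by
    simp [MeasurableEquiv.piFinSuccAbove, Fin.insertNthEquiv]
  simp only [hsn, jointDensity_snoc]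
  rw [lintegral_prod_symm]
  · refine lintegral_congr fun z => ?_
    simp only [propagate]
    have hm := (measurable_propagate_integrand M y hΦ).comp (measurable_prodMk_left (x := z))
    simp only [Function.comp_def] at hm
    rw [← lintegral_const_mul _ hm]
    refine lintegral_congr fun x => ?_
    rw [ENNReal.ofReal_mul (jointDensity_nonneg M y t z), mul_assoc]
  · refine Measurable.aemeasurable (Measurable.mul ?_ ?_)
    · have := (measurable_jointDensity M y (t + 1)).comp (measurable_snoc.comp
        (measurable_swap (α := X) (β := Fin (t + 1) → X)))
      simpa only [Function.comp_def, jointDensity_snoc, Prod.fst_swap, Prod.snd_swap] using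
        this.ennreal_ofReal
    · exact hΦ.comp (measurable_snoc.comp measurable_swap)

/-- The particle filter is unbiased: `E[p_N π_N(Φ)] = ∫ Φ(x_{1:t+1}) p(x_{1:t+1}, y_{1:t+1}) dx`. -/
theorem lintegral_unnormalisedEstimate (hN : 1 ≤ N) {T : ℕ} (hpos : WeightsPositive M Q y T)
    (hbdd : WeightsBounded M Q y T) (hr : UnbiasedResampling r) (t : ℕ) (ht : t + 1 ≤ T)
    {Φ : (Fin (t + 1) → X) → ℝ≥0∞} (hΦ : Measurable Φ) :
    ∫⁻ s, unnormalisedEstimate Φ s ∂(pfLaw M Q y r t) = ∫⁻ x, Φ x ∂(jointMeasure M y t) := by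
  have hN' : (N : ℝ≥0∞) ≠ 0 := by exact_mod_cast (by omega : N ≠ 0)
  induction t with
  | zero =>
    have : IsProbabilityMeasure (densityMeasure ν Q.q1) := Q.q1_density.isProbabilityMeasure
    have hm : Measurable fun x => ENNReal.ofReal (weight1 M Q y x) * Φ (fun _ => x) :=
      (measurable_weight1 M Q y).ennreal_ofReal.mul (hΦ.comp (by fun_prop))
    have hm' := fun i => hm.comp (measurable_pi_apply (X := fun _ : Fin N => X) i)
    simp only [Function.comp_def] at hm'
    have h1 : ∀ x : Fin N → X, unnormalisedEstimate Φ (initState M Q y x) =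
        (N : ℝ≥0∞)⁻¹ * ∑ i, ENNReal.ofReal (weight1 M Q y (x i)) * Φ (fun _ => x i) := fun x => by
      simp only [unnormalisedEstimate, initState, Finset.mul_sum]
      refine Finset.sum_congr rfl fun i _ => ?_
      rw [← mul_assoc, ofReal_avgWeight_mul_normWeights fun i => weight1_nonneg M Q y (x i),
        mul_assoc]
    simp only [pfLaw]
    rw [lintegral_map (measurable_unnormalisedEstimate hΦ) (measurable_initState M Q y)]
    simp only [h1]
    rw [lintegral_const_mul _ (Finset.measurable_sum _ fun i _ => hm' i),
      lintegral_finsetSum _ fun i _ => hm' i]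
    have h2 : ∀ i : Fin N, ∫⁻ x : Fin N → X, ENNReal.ofReal (weight1 M Q y (x i)) *
        Φ (fun _ => x i) ∂(Measure.pi fun _ : Fin N => densityMeasure ν Q.q1) =
        ∫⁻ x, Φ x ∂(jointMeasure M y 0) := fun i => by
      rw [lintegral_jointMeasure_zero M y hΦ]
      refine ((measurePreserving_eval (fun _ : Fin N => densityMeasure ν Q.q1) i).lintegral_comp
        hm).trans ?_
      rw [lintegral_densityMeasure Q.q1_density.1 hm]
      refine lintegral_congr fun x => ?_
      rw [← mul_assoc, ← ENNReal.ofReal_mul (Q.q1_density.2.1 x)]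
      congr 2
      by_cases h0 : Q.q1 x = 0
      · rw [(hpos.1 x).2 h0, h0, zero_mul]
      · rw [weight1, mul_div_cancel₀ _ h0]
    simp only [h2, Finset.sum_const, Finset.card_univ, Fintype.card_fin, nsmul_eq_mul]
    rw [← mul_assoc, ENNReal.inv_mul_cancel hN' (ENNReal.natCast_ne_top N), one_mul]
  | succ t ih =>
    rw [lintegral_pfLaw_succ _ _ _ _ _ (measurable_unnormalisedEstimate hΦ),
      lintegral_jointMeasure_succ M y t hΦ, ← ih (by omega) (measurable_propagate M y hΦ)]
    obtain ⟨B, hB⟩ := ae_regularState M Q y r hN hpos hbdd t (by omega)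
    refine lintegral_congr_ae ?_
    filter_upwards [hB] with s hs
    simp only [lintegral_unnormalisedEstimate_nextState M Q y hpos ht hΦ, mul_assoc]
    rw [← Finset.mul_sum, ← Finset.mul_sum,
      sum_resampling r hr hs.2.2 fun k => propagate M y Φ (s.1 k), ← mul_assoc (N : ℝ≥0∞)⁻¹,
      ENNReal.inv_mul_cancel hN' (ENNReal.natCast_ne_top N), one_mul]
    rfl

end SigmaFinite

/-! ### The independent Metropolis–Hastings transition -/

section Transition

variable {X : Type*} {N L : ℕ}

/-- One iteration of the chain: the new state, given the current state `v`, the proposal `z.1` and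
the uniform `z.2`. -/
noncomputable def mhStep (v : PFRun X N L) (z : PFRun X N L × ℝ) : PFRun X N L :=
  if z.2 ≤ accProb v.pN z.1.pN then z.1 else v

/-- The uniform distribution on `[0, 1]`. -/
noncomputable abbrev unif : Measure ℝ := volume.restrict (Set.Icc (0 : ℝ) 1)

instance : IsProbabilityMeasure unif := ⟨by simp⟩

lemma unif_Iic {a : ℝ} (ha : a ≤ 1) : unif (Set.Iic a) = ENNReal.ofReal a := by
  have : Set.Iic a ∩ Set.Icc 0 1 = Set.Icc 0 a := by
    ext x; simp only [Set.mem_inter_iff, Set.mem_Iic, Set.mem_Icc]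
    constructor
    · rintro ⟨h1, h2, h3⟩; exact ⟨h2, h1⟩
    · rintro ⟨h1, h2⟩; exact ⟨h2, h1, h2.trans ha⟩
  rw [Measure.restrict_apply measurableSet_Iic, this, Real.volume_Icc, sub_zero]

lemma unif_Ioi {a : ℝ} (ha0 : 0 ≤ a) (ha : a ≤ 1) :
    unif (Set.Ioi a) = ENNReal.ofReal (1 - a) := by
  rw [← Set.compl_Iic, prob_compl_eq_one_sub measurableSet_Iic, unif_Iic ha,
    ENNReal.ofReal_sub _ ha0, ENNReal.ofReal_one]

lemma unif_mhStep_mem {v v' : PFRun X N L} (hv : 0 < v.pN) (hv' : 0 < v'.pN)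
    (A : Set (PFRun X N L)) :
    ENNReal.ofReal v.pN * unif {u | mhStep v (v', u) ∈ A} +
        ENNReal.ofReal (min v.pN v'.pN) * A.indicator 1 v =
      ENNReal.ofReal (min v.pN v'.pN) * A.indicator 1 v' +
        ENNReal.ofReal v.pN * A.indicator 1 v := by
  have ha0 : 0 ≤ accProb v.pN v'.pN := le_min zero_le_one (div_nonneg hv'.le hv.le)
  have ha1 : accProb v.pN v'.pN ≤ 1 := min_le_left _ _
  have hmul : v.pN * accProb v.pN v'.pN = min v.pN v'.pN := by
    rw [accProb, mul_min_of_nonneg _ _ hv.le, mul_one, mul_div_cancel₀ _ hv.ne']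
  have h1 : ENNReal.ofReal v.pN * unif (Set.Iic (accProb v.pN v'.pN)) =
      ENNReal.ofReal (min v.pN v'.pN) := by
    rw [unif_Iic ha1, ← ENNReal.ofReal_mul hv.le, hmul]
  have h2 : ENNReal.ofReal v.pN * unif (Set.Ioi (accProb v.pN v'.pN)) +
      ENNReal.ofReal (min v.pN v'.pN) = ENNReal.ofReal v.pN := by
    rw [unif_Ioi ha0 ha1, ← ENNReal.ofReal_mul hv.le, ← hmul,
      ← ENNReal.ofReal_add (mul_nonneg hv.le (by linarith)) (mul_nonneg hv.le ha0)]
    congr 1; ring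
  by_cases hA : v ∈ A <;> by_cases hA' : v' ∈ A
  · have : {u | mhStep v (v', u) ∈ A} = Set.univ := by
      ext u; simp only [mhStep, Set.mem_ofPred_eq, Set.mem_univ, iff_true]; split_ifs <;> assumption
    simp [this, hA, hA', add_comm]
  · have : {u | mhStep v (v', u) ∈ A} = Set.Ioi (accProb v.pN v'.pN) := by
      ext u; simp only [mhStep, Set.mem_ofPred_eq, Set.mem_Ioi]; split_ifs with h <;> simp_all
    simp only [this, Set.indicator_of_mem hA, Set.indicator_of_notMem hA', Pi.one_apply, mul_one,
      mul_zero, zero_add, h2]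
  · have : {u | mhStep v (v', u) ∈ A} = Set.Iic (accProb v.pN v'.pN) := by
      ext u; simp only [mhStep, Set.mem_ofPred_eq, Set.mem_Iic]; split_ifs with h <;> simp_all
    simp only [this, Set.indicator_of_mem hA', Set.indicator_of_notMem hA, Pi.one_apply, mul_one,
      mul_zero, add_zero, h1]
  · have : {u | mhStep v (v', u) ∈ A} = ∅ := by
      ext u; simp only [mhStep, Set.mem_ofPred_eq, Set.mem_empty_iff_false, iff_false]
      split_ifs <;> assumption
    simp [this, hA, hA']

variable [MeasurableSpace X]

lemma measurable_pN : Measurable (PFRun.pN (X := X) (N := N) (L := L)) := by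
  unfold PFRun.pN; fun_prop

lemma measurable_mhStep {Ω : Type*} [MeasurableSpace Ω] {V : Ω → PFRun X N L}
    {Z : Ω → PFRun X N L × ℝ} (hV : Measurable V) (hZ : Measurable Z) :
    Measurable fun ω => mhStep (V ω) (Z ω) := by
  unfold mhStep accProb
  refine Measurable.ite (measurableSet_le hZ.snd ?_) hZ.fst hV
  exact measurable_const.min ((measurable_pN.comp hZ.fst).div (measurable_pN.comp hV))

/-- The law of the next state when the current state has law `μ` and the proposal has law `Λ`. -/
noncomputable def mhPush (Λ μ : Measure (PFRun X N L)) : Measure (PFRun X N L) :=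
  (μ.prod (Λ.prod unif)).map fun p => mhStep p.1 p.2

/-- The unnormalised target of the chain: the proposal law reweighted by the likelihood
estimate. -/
noncomputable def target (Λ : Measure (PFRun X N L)) : Measure (PFRun X N L) :=
  Λ.withDensity fun v => ENNReal.ofReal v.pN

variable {Λ : Measure (PFRun X N L)}

lemma lintegral_target {φ : PFRun X N L → ℝ≥0∞} (hφ : Measurable φ) :
    ∫⁻ v, φ v ∂(target Λ) = ∫⁻ v, ENNReal.ofReal v.pN * φ v ∂Λ := by
  rw [target, lintegral_withDensity_eq_lintegral_mul _ measurable_pN.ennreal_ofReal hφ]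
  rfl

/-- A proposal law under which the likelihood estimate is positive and bounded. -/
structure RegularProposal (Λ : Measure (PFRun X N L)) (B : ℝ) : Prop where
  isProb : IsProbabilityMeasure Λ
  pos : ∀ᵐ v ∂Λ, 0 < v.pN
  le : ∀ᵐ v ∂Λ, v.pN ≤ B

variable {B : ℝ}

lemma RegularProposal.bound_pos (h : RegularProposal Λ B) : 0 < B := by
  have := h.isProb
  obtain ⟨v, hv⟩ := (h.pos.and h.le).exists
  exact hv.1.trans_le hv.2

lemma RegularProposal.target_univ_le (h : RegularProposal Λ B) :
    target Λ Set.univ ≤ ENNReal.ofReal B := by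
  have := h.isProb
  rw [target, withDensity_apply _ .univ, Measure.restrict_univ]
  refine (lintegral_mono_ae ?_).trans (b := ∫⁻ _, ENNReal.ofReal B ∂Λ) (by simp)
  filter_upwards [h.le] with v hv using ENNReal.ofReal_le_ofReal hv

lemma RegularProposal.isFiniteMeasure_target (h : RegularProposal Λ B) :
    IsFiniteMeasure (target Λ) := ⟨h.target_univ_le.trans_lt ENNReal.ofReal_lt_top⟩

lemma RegularProposal.target_univ_pos (h : RegularProposal Λ B) : 0 < target Λ Set.univ := by
  have := h.isProb
  rw [target, withDensity_apply _ .univ, Measure.restrict_univ, pos_iff_ne_zero, Ne,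
    lintegral_eq_zero_iff measurable_pN.ennreal_ofReal]
  intro h0
  obtain ⟨v, hv1, hv2⟩ := (h.pos.and h0).exists
  simp only [Pi.zero_apply, ENNReal.ofReal_eq_zero] at hv2
  exact absurd hv1 (not_lt.2 hv2)

lemma target_absolutelyContinuous : target Λ ≪ Λ := withDensity_absolutelyContinuous _ _

lemma mhPush_apply [SFinite Λ] (μ : Measure (PFRun X N L)) {A : Set (PFRun X N L)}
    (hA : MeasurableSet A) :
    mhPush Λ μ A = ∫⁻ v, ∫⁻ v', unif {u | mhStep v (v', u) ∈ A} ∂Λ ∂μ := by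
  have hm : Measurable fun p : PFRun X N L × PFRun X N L × ℝ => mhStep p.1 p.2 :=
    measurable_mhStep measurable_fst measurable_snd
  rw [mhPush, Measure.map_apply hm hA, Measure.prod_apply (hm hA)]
  refine lintegral_congr fun v => ?_
  rw [Measure.prod_apply (measurable_prodMk_left (hm hA))]
  rfl

lemma mhPush_add [SFinite Λ] (μ μ' : Measure (PFRun X N L)) :
    mhPush Λ (μ + μ') = mhPush Λ μ + mhPush Λ μ' := by
  ext A hA
  simp only [Measure.add_apply, mhPush_apply _ hA, lintegral_add_measure]

lemma mhPush_smul [SFinite Λ] (c : ℝ≥0∞) (μ : Measure (PFRun X N L)) :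
    mhPush Λ (c • μ) = c • mhPush Λ μ := by
  ext A hA
  simp only [Measure.smul_apply, mhPush_apply _ hA, lintegral_smul_measure]

lemma mhPush_univ [IsProbabilityMeasure Λ] (μ : Measure (PFRun X N L)) :
    mhPush Λ μ Set.univ = μ Set.univ := by
  simp [mhPush_apply _ MeasurableSet.univ]

/-- Since `min(1, p*/p) ≥ p*/B` for `p ≤ B`, the chain moves to a draw from its target with
probability bounded below, whatever its current state. -/
lemma smul_target_le_mhPush (h : RegularProposal Λ B) {μ : Measure (PFRun X N L)}
    (hμ : ∀ᵐ v ∂μ, 0 < v.pN ∧ v.pN ≤ B) :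
    (μ Set.univ * ENNReal.ofReal B⁻¹) • target Λ ≤ mhPush Λ μ := by
  have := h.isProb
  refine Measure.le_iff.2 fun A hA => ?_
  have hB := h.bound_pos
  have h1 : ∀ᵐ v ∂μ, ENNReal.ofReal B⁻¹ * target Λ A ≤
      ∫⁻ v', unif {u | mhStep v (v', u) ∈ A} ∂Λ := by
    filter_upwards [hμ] with v hv
    rw [target, withDensity_apply _ hA, ← lintegral_const_mul _ measurable_pN.ennreal_ofReal,
      ← lintegral_indicator hA]
    refine lintegral_mono_ae ?_
    filter_upwards [h.pos, h.le] with v' hv1 hv2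
    by_cases hv' : v' ∈ A
    · rw [Set.indicator_of_mem hv', ← ENNReal.ofReal_mul (by positivity),
        ← unif_Iic (a := B⁻¹ * v'.pN) (by rwa [inv_mul_le_iff₀ hB, mul_one])]
      refine measure_mono fun u hu => ?_
      have : u ≤ accProb v.pN v'.pN := by
        refine le_min (hu.trans (by rwa [inv_mul_le_iff₀ hB, mul_one])) (hu.trans ?_)
        rw [div_eq_inv_mul]
        exact mul_le_mul_of_nonneg_right (inv_anti₀ hv.1 hv.2) hv1.le
      simpa [mhStep, this] using hv'
    · simp [hv']
  rw [mhPush_apply _ hA, Measure.smul_apply, smul_eq_mul, mul_assoc, mul_comm, ← lintegral_const]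
  exact lintegral_mono_ae h1

/-- The target is invariant, since `p min(1, p*/p) = min(p, p*)` is symmetric in `p` and `p*`. -/
lemma mhPush_target (h : RegularProposal Λ B) : mhPush Λ (target Λ) = target Λ := by
  have := h.isProb
  have := h.isFiniteMeasure_target
  ext A hA
  have hm : Measurable fun p : PFRun X N L × PFRun X N L =>
      unif {u | mhStep p.1 (p.2, u) ∈ A} :=
    measurable_measure_prodMk_left
      (s := {q : (PFRun X N L × PFRun X N L) × ℝ | mhStep q.1.1 (q.1.2, q.2) ∈ A})
      (measurable_mhStep (V := fun q : (PFRun X N L × PFRun X N L) × ℝ => q.1.1)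
        (Z := fun q => (q.1.2, q.2)) (by fun_prop) (by fun_prop) hA)
  have hi : Measurable (A.indicator (1 : PFRun X N L → ℝ≥0∞)) := measurable_one.indicator hA
  have hp := (measurable_pN (X := X) (N := N) (L := L))
  have hmin : Measurable fun p : PFRun X N L × PFRun X N L =>
      ENNReal.ofReal (min p.1.pN p.2.pN) := by fun_prop
  set I := ∫⁻ v, ∫⁻ v', ENNReal.ofReal (min v.pN v'.pN) * A.indicator 1 v ∂Λ ∂Λ with hI
  have hI' : ∫⁻ v, ∫⁻ v', ENNReal.ofReal (min v.pN v'.pN) * A.indicator 1 v' ∂Λ ∂Λ = I := by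
    rw [lintegral_lintegral_swap (hmin.mul (hi.comp measurable_snd)).aemeasurable]
    simp only [min_comm, hI]
  have hT : ∫⁻ v, ∫⁻ _, ENNReal.ofReal v.pN * A.indicator 1 v ∂Λ ∂Λ = target Λ A := by
    simp only [lintegral_const, measure_univ, mul_one]
    rw [← lintegral_target hi, lintegral_indicator_one hA]
  have hIfin : I ≠ ∞ := by
    refine ne_top_of_le_ne_top (measure_ne_top (target Λ) A) (hT ▸ ?_)
    refine lintegral_mono fun v => lintegral_mono fun v' => ?_
    gcongr
    exact min_le_left _ _
  have hm1 : Measurable fun v : PFRun X N L =>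
      ENNReal.ofReal v.pN * ∫⁻ v', unif {u | mhStep v (v', u) ∈ A} ∂Λ :=
    hp.ennreal_ofReal.mul hm.lintegral_prod_right'
  have hm2 : Measurable fun v : PFRun X N L =>
      ∫⁻ v', ENNReal.ofReal (min v.pN v'.pN) * A.indicator 1 v' ∂Λ :=
    (hmin.mul (hi.comp measurable_snd)).lintegral_prod_right'
  have key : mhPush Λ (target Λ) A +
      ∫⁻ v, ∫⁻ v', ENNReal.ofReal (min v.pN v'.pN) * A.indicator 1 v ∂Λ ∂Λ =
      ∫⁻ v, ∫⁻ v', ENNReal.ofReal (min v.pN v'.pN) * A.indicator 1 v' ∂Λ ∂Λ +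
        ∫⁻ v, ∫⁻ _, ENNReal.ofReal v.pN * A.indicator 1 v ∂Λ ∂Λ := by
    rw [mhPush_apply _ hA, lintegral_target hm.lintegral_prod_right',
      ← lintegral_add_left hm1, ← lintegral_add_left hm2]
    refine lintegral_congr_ae ?_
    filter_upwards [h.pos] with v hv
    have hmk : Measurable fun v' : PFRun X N L => (v, v') := measurable_prodMk_left
    have hmv : Measurable fun v' => unif {u | mhStep v (v', u) ∈ A} :=
      Measurable.comp (f := fun v' => (v, v')) hm hmk
    have hminv : Measurable fun v' : PFRun X N L => ENNReal.ofReal (min v.pN v'.pN) :=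
      Measurable.comp (f := fun v' => (v, v')) hmin hmk
    have hm3 : Measurable fun v' : PFRun X N L =>
        ENNReal.ofReal (min v.pN v'.pN) * A.indicator 1 v' := hminv.mul hi
    rw [← lintegral_const_mul _ hmv]
    refine (lintegral_add_left (hmv.const_mul _) _).symm.trans
      (Eq.trans ?_ (lintegral_add_left hm3 _))
    refine lintegral_congr_ae ?_
    filter_upwards [h.pos] with v' hv' using unif_mhStep_mem hv hv' A
  rw [hI', hT, ← hI, add_comm I] at key
  exact (ENNReal.add_left_inj hIfin).1 key

end Transition

/-! ### Geometric ergodicity of the chain -/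

section Chain

variable {X : Type*} {N L : ℕ}

lemma chain_succ (ξ : ℕ → PFRun X N L) (u : ℕ → ℝ) (n : ℕ) :
    chain ξ u (n + 1) = mhStep (chain ξ u n) (ξ (n + 1), u (n + 1)) := rfl

/-- The second chain is the first one driven by the inputs shifted by one iteration. -/
lemma lagChain_eq_chain (ξ : ℕ → PFRun X N L) (u : ℕ → ℝ) (n : ℕ) :
    lagChain ξ u n = chain (fun i => ξ (i + 1)) (fun i => u (i + 1)) n := by
  induction n with
  | zero => rfl
  | succ n ih => simp only [lagChain, chain, ih]

lemma chain_mem {S : Set (PFRun X N L)} {ξ : ℕ → PFRun X N L} (h : ∀ n, ξ n ∈ S) (u : ℕ → ℝ)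
    (n : ℕ) : chain ξ u n ∈ S := by
  induction n with
  | zero => exact h 0
  | succ n ih =>
    rw [chain_succ, mhStep]
    split_ifs
    exacts [h _, ih]

variable [MeasurableSpace X] {Ω : Type*}

/-- The random inputs of the algorithm: independent pairs of a proposal with law `Λ` and an
independent uniform. -/
structure IIDInputs [MeasurableSpace Ω] (P : Measure Ω) (Λ : Measure (PFRun X N L))
    (ξ : ℕ → Ω → PFRun X N L) (u : ℕ → Ω → ℝ) : Prop where
  measurable : ∀ n, Measurable fun ω => (ξ n ω, u n ω)
  law : ∀ n, P.map (fun ω => (ξ n ω, u n ω)) = Λ.prod unif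
  indep : iIndepFun (fun n ω => (ξ n ω, u n ω)) P

lemma measurable_chain_of_le [MeasurableSpace Ω] {ξ : ℕ → Ω → PFRun X N L} {u : ℕ → Ω → ℝ} (n : ℕ)
    (h : ∀ i ≤ n, Measurable fun ω => (ξ i ω, u i ω)) :
    Measurable fun ω => chain (ξ · ω) (u · ω) n := by
  induction n with
  | zero => exact (h 0 le_rfl).fst
  | succ n ih =>
    simp only [chain_succ]
    exact measurable_mhStep (ih fun i hi => h i (by omega)) (h (n + 1) le_rfl)

variable [MeasurableSpace Ω] {P : Measure Ω} {Λ : Measure (PFRun X N L)}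
  {ξ : ℕ → Ω → PFRun X N L} {u : ℕ → Ω → ℝ}

lemma IIDInputs.measurable_chain (h : IIDInputs P Λ ξ u) (n : ℕ) :
    Measurable fun ω => chain (ξ · ω) (u · ω) n :=
  measurable_chain_of_le n fun i _ => h.measurable i

lemma IIDInputs.shift (h : IIDInputs P Λ ξ u) :
    IIDInputs P Λ (fun n => ξ (n + 1)) (fun n => u (n + 1)) where
  measurable n := h.measurable (n + 1)
  law n := h.law (n + 1)
  indep := h.indep.precomp (add_left_injective 1)

lemma IIDInputs.map_run (h : IIDInputs P Λ ξ u) [SFinite Λ] (n : ℕ) : P.map (ξ n) = Λ := by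
  have := congrArg (Measure.map Prod.fst) (h.law n)
  rwa [Measure.map_map measurable_fst (h.measurable n), Measure.map_fst_prod, measure_univ,
    one_smul] at this

lemma IIDInputs.indepFun_chain (h : IIDInputs P Λ ξ u) (n : ℕ) :
    IndepFun (fun ω => chain (ξ · ω) (u · ω) n) (fun ω => (ξ (n + 1) ω, u (n + 1) ω)) P := by
  have h1 := indep_iSup_of_disjoint
    (m := fun i => MeasurableSpace.comap (fun ω => (ξ i ω, u i ω)) inferInstance)
    (fun i => (h.measurable i).comap_le) h.indep (S := Set.Iic n) (T := {n + 1}) (by simp)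
  rw [IndepFun_iff_Indep]
  refine indep_of_indep_of_le_left (indep_of_indep_of_le_right h1 (by simp)) ?_
  refine Measurable.comap_le ?_
  refine @measurable_chain_of_le _ _ _ _ _
    (⨆ i ∈ Set.Iic n, MeasurableSpace.comap (fun ω => (ξ i ω, u i ω)) inferInstance) _ _ n ?_
  intro i hi
  exact Measurable.mono (comap_measurable _)
    (le_iSup₂ (f := fun i (_ : i ∈ Set.Iic n) =>
      MeasurableSpace.comap (fun ω => (ξ i ω, u i ω)) inferInstance) i hi) le_rfl

lemma IIDInputs.map_chain_succ [IsProbabilityMeasure P] (h : IIDInputs P Λ ξ u) (n : ℕ) :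
    P.map (fun ω => chain (ξ · ω) (u · ω) (n + 1)) =
      mhPush Λ (P.map fun ω => chain (ξ · ω) (u · ω) n) := by
  have h1 := (indepFun_iff_map_prod_eq_prod_map_map (h.measurable_chain n).aemeasurable
    (h.measurable (n + 1)).aemeasurable).1 (h.indepFun_chain n)
  rw [h.law (n + 1)] at h1
  rw [mhPush, ← h1, Measure.map_map (measurable_mhStep measurable_fst measurable_snd)
    ((h.measurable_chain n).prodMk (h.measurable (n + 1)))]
  rfl

/-- Both chains have the same one-dimensional laws. -/
lemma IIDInputs.map_lagChain [IsProbabilityMeasure P] [SFinite Λ] (h : IIDInputs P Λ ξ u) (n : ℕ) :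
    P.map (fun ω => lagChain (ξ · ω) (u · ω) n) = P.map (fun ω => chain (ξ · ω) (u · ω) n) := by
  simp only [lagChain_eq_chain]
  induction n with
  | zero => exact (h.shift.map_run 0).trans (h.map_run 0).symm
  | succ n ih => rw [h.shift.map_chain_succ, ih, h.map_chain_succ]

variable {B : ℝ}

lemma IIDInputs.ae_run (h : IIDInputs P Λ ξ u) (hΛ : RegularProposal Λ B) :
    ∀ᵐ ω ∂P, ∀ n, 0 < (ξ n ω).pN ∧ (ξ n ω).pN ≤ B := by
  have := hΛ.isProb
  rw [ae_all_iff]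
  intro n
  have h1 : ∀ᵐ v ∂(P.map (ξ n)), 0 < v.pN ∧ v.pN ≤ B := by
    rw [h.map_run n]
    exact hΛ.pos.and hΛ.le
  exact ae_of_ae_map (h.measurable n).fst.aemeasurable h1

lemma IIDInputs.ae_chain (h : IIDInputs P Λ ξ u) (hΛ : RegularProposal Λ B) (n : ℕ) :
    ∀ᵐ v ∂(P.map fun ω => chain (ξ · ω) (u · ω) n), 0 < v.pN ∧ v.pN ≤ B := by
  have hm : MeasurableSet {v : PFRun X N L | 0 < v.pN ∧ v.pN ≤ B} :=
    (measurableSet_lt measurable_const measurable_pN).inter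
      (measurableSet_le measurable_pN measurable_const)
  rw [ae_map_iff (h.measurable_chain n).aemeasurable hm]
  filter_upwards [h.ae_run hΛ] with ω hω using chain_mem (S := {v | 0 < v.pN ∧ v.pN ≤ B}) hω _ n

/-- The mean acceptance probability `E[p*/B]` of a proposal against the worst possible current
state. -/
noncomputable def minAccept (Λ : Measure (PFRun X N L)) (B : ℝ) : ℝ≥0∞ :=
  ENNReal.ofReal B⁻¹ * target Λ Set.univ

lemma minAccept_le_one (hΛ : RegularProposal Λ B) : minAccept Λ B ≤ 1 := by
  refine (mul_le_mul_right hΛ.target_univ_le _).trans ?_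
  rw [← ENNReal.ofReal_mul (inv_nonneg.2 hΛ.bound_pos.le), inv_mul_cancel₀ hΛ.bound_pos.ne',
    ENNReal.ofReal_one]

lemma minAccept_pos (hΛ : RegularProposal Λ B) : 0 < minAccept Λ B :=
  ENNReal.mul_pos (by simpa using hΛ.bound_pos) hΛ.target_univ_pos.ne'

/-- After `n` iterations the law of the chain is a multiple of the target up to a remainder of
geometrically small mass. -/
lemma IIDInputs.exists_map_chain_eq [IsProbabilityMeasure P] (h : IIDInputs P Λ ξ u)
    (hΛ : RegularProposal Λ B) (n : ℕ) :
    ∃ (c : ℝ≥0∞) (μ : Measure (PFRun X N L)),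
      P.map (fun ω => chain (ξ · ω) (u · ω) n) = c • target Λ + μ ∧
        μ Set.univ = (1 - minAccept Λ B) ^ n := by
  have := hΛ.isProb
  have := hΛ.isFiniteMeasure_target
  induction n with
  | zero => exact ⟨0, Λ, by rw [zero_smul, zero_add]; exact h.map_run 0, by simp⟩
  | succ n ih =>
    obtain ⟨c, μ, h1, h2⟩ := ih
    have hle : μ ≤ P.map (fun ω => chain (ξ · ω) (u · ω) n) := h1 ▸ Measure.le_add_left le_rfl
    have hμ : ∀ᵐ v ∂μ, 0 < v.pN ∧ v.pN ≤ B := hle.absolutelyContinuous (h.ae_chain hΛ n)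
    have hfin : μ Set.univ ≠ ∞ := by
      rw [h2]; exact ENNReal.pow_ne_top (ne_top_of_le_ne_top ENNReal.one_ne_top tsub_le_self)
    set d := μ Set.univ * ENNReal.ofReal B⁻¹ with hd
    have hdfin : d ≠ ∞ := ENNReal.mul_ne_top hfin ENNReal.ofReal_ne_top
    have : IsFiniteMeasure (d • target Λ) := (target Λ).smul_finite hdfin
    have h3 := Measure.sub_add_cancel_of_le (smul_target_le_mhPush hΛ hμ)
    refine ⟨c + d, mhPush Λ μ - d • target Λ, ?_, ?_⟩
    · rw [h.map_chain_succ, h1, mhPush_add, mhPush_smul, mhPush_target hΛ, add_smul, add_assoc,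
        add_comm (d • target Λ), h3]
    · have h4 := congrArg (fun m => m Set.univ) h3
      simp only [Measure.add_apply, Measure.smul_apply, smul_eq_mul, mhPush_univ] at h4
      rw [pow_succ, ← h2, ENNReal.mul_sub fun _ _ => hfin, mul_one, minAccept, ← mul_assoc]
      refine ENNReal.eq_sub_of_add_eq ?_ h4
      exact ENNReal.mul_ne_top hdfin (measure_ne_top _ _)

/-- A uniform bound on the second moments along the chain makes `G` integrable under the target,
and the means along the chain converge to the mean under the normalised target. -/
theorem IIDInputs.tendsto_integral_chain [IsProbabilityMeasure P] (h : IIDInputs P Λ ξ u)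
    (hΛ : RegularProposal Λ B) {G : PFRun X N L → ℝ} (hG : Measurable G) {C : ℝ≥0∞} (hC : C ≠ ∞)
    (hmom : ∀ n, eLpNorm (fun ω => G (chain (ξ · ω) (u · ω) n)) 2 P ≤ C) :
    Integrable G (target Λ) ∧
      Filter.Tendsto (fun n => ∫ ω, G (chain (ξ · ω) (u · ω) n) ∂P) Filter.atTop
        (nhds ((target Λ Set.univ).toReal⁻¹ * ∫ v, G v ∂(target Λ))) := by
  have := hΛ.isProb
  have := hΛ.isFiniteMeasure_target
  choose c μ hcμ hμ using h.exists_map_chain_eq hΛ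
  set Z := target Λ Set.univ with hZ
  set q := 1 - minAccept Λ B with hq
  have hq1 : q < 1 := ENNReal.sub_lt_self ENNReal.one_ne_top one_ne_zero (minAccept_pos hΛ).ne'
  have hZ0 : Z ≠ 0 := hΛ.target_univ_pos.ne'
  have hZfin : Z ≠ ∞ := measure_ne_top _ _
  have hmass : ∀ n, c n * Z + q ^ n = 1 := fun n => by
    have := congrArg (fun m => m Set.univ) (hcμ n)
    simp only [Measure.add_apply, Measure.smul_apply, smul_eq_mul, hμ] at this
    rw [← this, Measure.map_apply (h.measurable_chain n) .univ]
    simp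
  have hcfin : ∀ n, c n ≠ ∞ := fun n hc => by
    have := hmass n
    rw [hc, ENNReal.top_mul hZ0] at this
    simp at this
  have hlaw : ∀ n, eLpNorm G 2 (P.map fun ω => chain (ξ · ω) (u · ω) n) ≤ C := fun n => by
    rw [eLpNorm_map_measure hG.aestronglyMeasurable (h.measurable_chain n).aemeasurable]
    exact hmom n
  have hint : ∀ n, Integrable G (P.map fun ω => chain (ξ · ω) (u · ω) n) := fun n => by
    have : IsProbabilityMeasure (P.map fun ω => chain (ξ · ω) (u · ω) n) :=
      Measure.isProbabilityMeasure_map (h.measurable_chain n).aemeasurable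
    exact MemLp.integrable (q := 2) one_le_two
      ⟨hG.aestronglyMeasurable, (hlaw n).trans_lt hC.lt_top⟩
  have hT : Integrable G (target Λ) := by
    have h1 := hint 1
    rw [hcμ 1, integrable_add_measure] at h1
    refine (integrable_smul_measure (fun h0 => ?_) (hcfin 1)).1 h1.1
    have := hmass 1
    rw [h0, zero_mul, zero_add, pow_one] at this
    exact hq1.ne this
  refine ⟨hT, ?_⟩
  have hμle : ∀ n, μ n ≤ P.map fun ω => chain (ξ · ω) (u · ω) n := fun n =>
    (hcμ n).symm ▸ Measure.le_add_left le_rfl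
  have hμint : ∀ n, Integrable G (μ n) := fun n => (hint n).mono_measure (hμle n)
  -- by the Cauchy–Schwarz inequality the remainder contributes little to the mean
  have hrem : Filter.Tendsto (fun n => ∫ v, G v ∂(μ n)) Filter.atTop (nhds 0) := by
    have h1 : Filter.Tendsto (fun n => (C * (q ^ n) ^ (1 / 2 : ℝ)).toReal) Filter.atTop
        (nhds 0) := by
      have h2 := ((ENNReal.tendsto_pow_atTop_nhds_zero_of_lt_one hq1).ennrpow_const (1 / 2 : ℝ))
      rw [ENNReal.zero_rpow_of_pos (by norm_num)] at h2
      have h3 := ENNReal.Tendsto.const_mul h2 (Or.inr hC)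
      rw [mul_zero] at h3
      exact (ENNReal.tendsto_toReal ENNReal.zero_ne_top).comp h3
    refine squeeze_zero_norm (fun n => ?_) h1
    have h2 : eLpNorm G 1 (μ n) ≤ C * (q ^ n) ^ (1 / 2 : ℝ) := by
      refine (eLpNorm_le_eLpNorm_mul_rpow_measure_univ one_le_two
        hG.aestronglyMeasurable).trans ?_
      rw [hμ n]
      refine mul_le_mul' ((eLpNorm_mono_measure G (hμle n)).trans (hlaw n)) (le_of_eq ?_)
      norm_num
    refine (norm_integral_le_lintegral_norm _).trans ?_
    refine ENNReal.toReal_mono ?_ ?_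
    · refine ENNReal.mul_ne_top hC (ENNReal.rpow_ne_top_of_nonneg (by norm_num) ?_)
      exact ENNReal.pow_ne_top hq1.ne_top
    · rw [eLpNorm_one_eq_lintegral_enorm] at h2
      simpa only [ofReal_norm] using h2
  have hc : Filter.Tendsto (fun n => (c n).toReal) Filter.atTop (nhds Z.toReal⁻¹) := by
    have h1 : ∀ n, (c n).toReal = Z.toReal⁻¹ * (1 - q.toReal ^ n) := fun n => by
      have := congrArg ENNReal.toReal (hmass n)
      rw [ENNReal.toReal_add (ENNReal.mul_ne_top (hcfin n) hZfin) (ENNReal.pow_ne_top hq1.ne_top),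
        ENNReal.toReal_mul, ENNReal.toReal_pow, ENNReal.toReal_one] at this
      rw [← this, add_sub_cancel_right, mul_comm, mul_assoc,
        mul_inv_cancel₀ (ENNReal.toReal_ne_zero.2 ⟨hZ0, hZfin⟩), mul_one]
    simp only [h1]
    have h2 := tendsto_pow_atTop_nhds_zero_of_lt_one (r := q.toReal) ENNReal.toReal_nonneg
      (by simpa using (ENNReal.toReal_lt_toReal hq1.ne_top ENNReal.one_ne_top).2 hq1)
    simpa using (h2.const_sub 1).const_mul Z.toReal⁻¹
  have hsum : ∀ n, ∫ ω, G (chain (ξ · ω) (u · ω) n) ∂P =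
      (c n).toReal * ∫ v, G v ∂(target Λ) + ∫ v, G v ∂(μ n) := fun n => by
    rw [← integral_map (h.measurable_chain n).aemeasurable hG.aestronglyMeasurable, hcμ n,
      integral_add_measure (hT.smul_measure (hcfin n)) (hμint n), integral_smul_measure,
      smul_eq_mul]
  simp only [hsum]
  simpa using (hc.mul_const _).add hrem

end Chain

/-! ### The meeting time -/

section MeetingTime

variable {X : Type*} {N L : ℕ}

lemma not_accept_of_lt_meetingTime {ξ : ℕ → PFRun X N L} {u : ℕ → ℝ} {l i : ℕ}
    (h : (l : ℕ∞) < meetingTime ξ u) (hi1 : 1 ≤ i) (hil : i ≤ l) :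
    ¬ u i ≤ min (acc ξ u i) (lagAcc ξ u i) := fun hi => by
  have h1 : meetingTime ξ u ≤ i := iInf₂_le i ⟨hi1, hi⟩
  exact absurd (h.trans_le h1) (not_lt.2 (by exact_mod_cast hil))

/-- Once both chains have accepted the same proposal they stay equal. -/
lemma chain_eq_lagChain {ξ : ℕ → PFRun X N L} {u : ℕ → ℝ} {l : ℕ}
    (h : meetingTime ξ u ≤ (l + 1 : ℕ)) : chain ξ u (l + 1) = lagChain ξ u l := by
  obtain ⟨n, ⟨hn1, hn⟩, hnl⟩ : ∃ n ∈ {n : ℕ | 1 ≤ n ∧ u n ≤ min (acc ξ u n) (lagAcc ξ u n)},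
      n ≤ l + 1 := by
    by_contra! hcon
    have h1 : ((l + 1 + 1 : ℕ) : ℕ∞) ≤ meetingTime ξ u :=
      le_iInf₂ fun n hn => by exact_mod_cast hcon n hn
    have h2 := h1.trans h
    norm_cast at h2
    omega
  obtain ⟨n, rfl⟩ : ∃ n', n = n' + 1 := ⟨n - 1, by omega⟩
  obtain ⟨d, rfl⟩ : ∃ d, l = n + d := ⟨l - n, by omega⟩
  clear hnl h
  induction d with
  | zero =>
    have h1 : chain ξ u (n + 1) = ξ (n + 1) := if_pos (hn.trans (min_le_left _ _))
    rw [Nat.add_zero, h1]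
    cases n with
    | zero => rfl
    | succ n =>
      refine (if_pos ?_).symm
      have h2 := hn.trans (min_le_right _ _)
      rwa [lagAcc, if_neg (by omega)] at h2
  | succ d ih =>
    change mhStep (chain ξ u (n + d + 1)) (ξ (n + d + 2), u (n + d + 2)) =
      mhStep (lagChain ξ u (n + d)) (ξ (n + d + 2), u (n + d + 2))
    rw [ih]

lemma accept_of_le {ξ : ℕ → PFRun X N L} {u : ℕ → ℝ} {B : ℝ}
    (hξ : ∀ n, 0 < (ξ n).pN ∧ (ξ n).pN ≤ B) {i : ℕ} (hi : u i ≤ B⁻¹ * (ξ i).pN) :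
    u i ≤ min (acc ξ u i) (lagAcc ξ u i) := by
  have hB : 0 < B := (hξ 0).1.trans_le (hξ 0).2
  have h1 : B⁻¹ * (ξ i).pN ≤ 1 := by rw [inv_mul_le_iff₀ hB, mul_one]; exact (hξ i).2
  have key : ∀ v : PFRun X N L, 0 < v.pN ∧ v.pN ≤ B → u i ≤ accProb v.pN (ξ i).pN := fun v hv => by
    refine le_min (hi.trans h1) (hi.trans ?_)
    rw [div_eq_inv_mul]
    exact mul_le_mul_of_nonneg_right (inv_anti₀ hv.1 hv.2) (hξ i).1.le
  refine le_min (key _ (chain_mem (S := {v | 0 < v.pN ∧ v.pN ≤ B}) hξ u _)) ?_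
  rw [lagAcc]
  split_ifs
  · exact hi.trans h1
  · refine key _ ?_
    rw [lagChain_eq_chain]
    exact chain_mem (S := {v | 0 < v.pN ∧ v.pN ≤ B}) (fun n => hξ (n + 1)) _ _

lemma coe_le_tsum_indicator (t : ℕ∞) :
    (t : ℝ≥0∞) ≤ ∑' l : ℕ, if (l : ℕ∞) < t then 1 else 0 := by
  induction t using ENat.recTopCoe with
  | top => simp
  | coe t =>
    refine le_trans ?_ (ENNReal.sum_le_tsum (Finset.range t))
    rw [Finset.sum_congr rfl (g := fun _ => 1) fun l hl => if_pos (by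
      exact_mod_cast Finset.mem_range.1 hl)]
    simp

variable [MeasurableSpace X] {Ω : Type*}

/-- None of the uniforms up to iteration `l` is small enough to make every regular state accept the
proposal. -/
def rejectSet (ξ : ℕ → Ω → PFRun X N L) (u : ℕ → Ω → ℝ) (B : ℝ) (l : ℕ) : Set Ω :=
  ⋂ i ∈ Finset.Icc 1 l, (fun ω => (ξ i ω, u i ω)) ⁻¹' {p | p.2 ≤ B⁻¹ * p.1.pN}ᶜ

lemma measurableSet_accept (B : ℝ) :
    MeasurableSet {p : PFRun X N L × ℝ | p.2 ≤ B⁻¹ * p.1.pN} :=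
  measurableSet_le measurable_snd ((measurable_pN.comp measurable_fst).const_mul _)

variable [MeasurableSpace Ω] {P : Measure Ω} {Λ : Measure (PFRun X N L)}
  {ξ : ℕ → Ω → PFRun X N L} {u : ℕ → Ω → ℝ} {B : ℝ}

lemma IIDInputs.measurableSet_rejectSet (h : IIDInputs P Λ ξ u) (l : ℕ) :
    MeasurableSet (rejectSet ξ u B l) :=
  Finset.measurableSet_biInter _ fun i _ => h.measurable i (measurableSet_accept B).compl

lemma IIDInputs.measure_rejectSet [IsProbabilityMeasure P] (h : IIDInputs P Λ ξ u)
    (hΛ : RegularProposal Λ B) (l : ℕ) :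
    P (rejectSet ξ u B l) = (1 - minAccept Λ B) ^ l := by
  have := hΛ.isProb
  have hacc : (Λ.prod unif) {p | p.2 ≤ B⁻¹ * p.1.pN} = minAccept Λ B := by
    rw [Measure.prod_apply (measurableSet_accept B), minAccept, target,
      withDensity_apply _ .univ, Measure.restrict_univ,
      ← lintegral_const_mul _ measurable_pN.ennreal_ofReal]
    refine lintegral_congr_ae ?_
    filter_upwards [hΛ.le] with v hv
    have hB := hΛ.bound_pos
    rw [← ENNReal.ofReal_mul (by positivity),
      ← unif_Iic (a := B⁻¹ * v.pN) (by rwa [inv_mul_le_iff₀ hB, mul_one])]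
    rfl
  rw [rejectSet, h.indep.measure_inter_preimage_eq_mul (Finset.Icc 1 l)
    (sets := fun _ => {p | p.2 ≤ B⁻¹ * p.1.pN}ᶜ) fun _ _ => (measurableSet_accept B).compl]
  have h1 : ∀ i, P ((fun ω => (ξ i ω, u i ω)) ⁻¹' {p | p.2 ≤ B⁻¹ * p.1.pN}ᶜ) =
      1 - minAccept Λ B := fun i => by
    rw [← Measure.map_apply (h.measurable i) (measurableSet_accept B).compl, h.law i,
      prob_compl_eq_one_sub (measurableSet_accept B), hacc]
  rw [Finset.prod_congr rfl fun i _ => h1 i, Finset.prod_const, Nat.card_Icc, Nat.add_sub_cancel]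

/-- If the chains have not met after `l` iterations then all proposals so far came with too large a
uniform. -/
lemma IIDInputs.ae_mem_rejectSet (h : IIDInputs P Λ ξ u) (hΛ : RegularProposal Λ B) :
    ∀ᵐ ω ∂P, ∀ l : ℕ, (l : ℕ∞) < meetingTime (ξ · ω) (u · ω) → ω ∈ rejectSet ξ u B l := by
  filter_upwards [h.ae_run hΛ] with ω hω l hl
  refine Set.mem_iInter₂.2 fun i hi => ?_
  have hi' := Finset.mem_Icc.1 hi
  exact fun hacc => not_accept_of_lt_meetingTime hl hi'.1 hi'.2 
    (accept_of_le (u := (u · ω)) hω hacc)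

lemma IIDInputs.lintegral_meetingTime_lt_top [IsProbabilityMeasure P] (h : IIDInputs P Λ ξ u)
    (hΛ : RegularProposal Λ B) :
    ∫⁻ ω, (meetingTime (ξ · ω) (u · ω) : ℝ≥0∞) ∂P < ∞ := by
  have h1 : ∫⁻ ω, (meetingTime (ξ · ω) (u · ω) : ℝ≥0∞) ∂P ≤
      ∫⁻ ω, ∑' l, (rejectSet ξ u B l).indicator 1 ω ∂P := by
    refine lintegral_mono_ae ?_
    filter_upwards [h.ae_mem_rejectSet hΛ] with ω hω
    refine (coe_le_tsum_indicator _).trans (ENNReal.tsum_le_tsum fun l => ?_)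
    split_ifs with hl
    · simp [hω l hl]
    · exact zero_le
  refine h1.trans_lt ?_
  rw [lintegral_tsum fun l => (measurable_one.indicator (h.measurableSet_rejectSet l)).aemeasurable]
  simp only [lintegral_indicator_one (h.measurableSet_rejectSet _), h.measure_rejectSet hΛ,
    ENNReal.tsum_geometric, ENNReal.sub_sub_cancel ENNReal.one_ne_top (minAccept_le_one hΛ)]
  exact ENNReal.inv_lt_top.2 (minAccept_pos hΛ)

lemma IIDInputs.lintegral_cost_lt_top [IsProbabilityMeasure P] (h : IIDInputs P Λ ξ u)
    (hΛ : RegularProposal Λ B) (m : ℕ) :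
    ∫⁻ ω, (cost m (ξ · ω) (u · ω) : ℝ≥0∞) ∂P < ∞ := by
  have h1 : ∫⁻ ω, (cost m (ξ · ω) (u · ω) : ℝ≥0∞) ∂P ≤
      ∫⁻ ω, (1 + m + (meetingTime (ξ · ω) (u · ω) : ℝ≥0∞)) ∂P := by
    refine lintegral_mono fun ω => ?_
    have : cost m (ξ · ω) (u · ω) ≤ 1 + m + meetingTime (ξ · ω) (u · ω) := by
      rw [cost, add_assoc]
      gcongr
      exact max_le le_self_add le_add_self
    simpa using ENat.toENNReal_le.2 this
  refine h1.trans_lt ?_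
  rw [lintegral_add_left measurable_const]
  exact ENNReal.add_lt_top.2 ⟨by simp, h.lintegral_meetingTime_lt_top hΛ⟩

lemma IIDInputs.ae_meetingTime_ne_top [IsProbabilityMeasure P] (h : IIDInputs P Λ ξ u)
    (hΛ : RegularProposal Λ B) : ∀ᵐ ω ∂P, meetingTime (ξ · ω) (u · ω) ≠ ⊤ := by
  have := hΛ.isProb
  have hq : 1 - minAccept Λ B < 1 :=
    ENNReal.sub_lt_self ENNReal.one_ne_top one_ne_zero (minAccept_pos hΛ).ne'
  have h0 : P (⋂ l, rejectSet ξ u B l) = 0 := by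
    refine le_antisymm (ge_of_tendsto' (ENNReal.tendsto_pow_atTop_nhds_zero_of_lt_one hq)
      fun l => ?_) zero_le
    rw [← h.measure_rejectSet hΛ l]
    exact measure_mono (Set.iInter_subset _ l)
  filter_upwards [h.ae_mem_rejectSet hΛ, measure_eq_zero_iff_ae_notMem.1 h0] with ω h1 h2 htop
  exact h2 (Set.mem_iInter.2 fun l => h1 l (htop ▸ ENat.natCast_lt_top l))

end MeetingTime

/-! ### Series of square integrable random variables -/

section Series

variable {Ω : Type*} [MeasurableSpace Ω] {P : Measure Ω}

/-- An almost surely convergent series whose terms have summable `L²` norms is square integrable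
and can be integrated term by term. -/
lemma memLp_and_hasSum_integral [IsProbabilityMeasure P] {f : ℕ → Ω → ℝ} {g : Ω → ℝ}
    (hf : ∀ j, AEStronglyMeasurable (f j) P) (hsum : ∑' j, eLpNorm (f j) 2 P ≠ ∞)
    (hg : ∀ᵐ ω ∂P, HasSum (f · ω) (g ω)) :
    MemLp g 2 P ∧ HasSum (fun j => ∫ ω, f j ω ∂P) (∫ ω, g ω ∂P) := by
  have hlim : ∀ᵐ ω ∂P, Filter.Tendsto (fun n => ∑ j ∈ Finset.range n, f j ω) Filter.atTop
      (nhds (g ω)) := hg.mono fun ω hω => hω.tendsto_sum_nat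
  have hpart : ∀ n, AEStronglyMeasurable (fun ω => ∑ j ∈ Finset.range n, f j ω) P := fun n =>
    Finset.aestronglyMeasurable_fun_sum _ fun j _ => hf j
  have hfin : ∀ j, eLpNorm (f j) 2 P ≠ ∞ := fun j => ENNReal.ne_top_of_tsum_ne_top hsum j
  refine ⟨⟨aestronglyMeasurable_of_tendsto_ae _ hpart hlim, lt_of_le_of_lt
    (Lp.eLpNorm_le_of_ae_tendsto (Filter.Eventually.of_forall fun n => ?_) hpart hlim) hsum.lt_top⟩,
    ?_⟩
  · have h1 := eLpNorm_sum_le (μ := P) (s := Finset.range n) (fun j _ => hf j) one_le_two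
    refine le_trans (le_of_eq ?_) (h1.trans (ENNReal.sum_le_tsum _))
    congr 1; ext ω; simp
  · rw [← integral_congr_ae (hg.mono fun ω hω => hω.tsum_eq)]
    refine hasSum_integral_of_summable_integral_norm
      (fun j => MemLp.integrable one_le_two ⟨hf j, (hfin j).lt_top⟩) ?_
    refine Summable.of_nonneg_of_le (fun j => integral_nonneg fun ω => norm_nonneg _) (fun j => ?_)
      (ENNReal.summable_toReal hsum)
    rw [integral_norm_eq_lintegral_enorm (hf j), ← eLpNorm_one_eq_lintegral_enorm]
    exact ENNReal.toReal_mono (hfin j) (eLpNorm_le_eLpNorm_of_exponent_le one_le_two (hf j))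

/-- A random variable with a moment of order `p > 2` that lives on a small event has a small `L²`
norm. -/
lemma eLpNorm_two_le_of_ae_eq_zero {f : Ω → ℝ} (hf : AEStronglyMeasurable f P) {p : ℝ≥0∞}
    (hp : 2 ≤ p) {F : Set Ω} (hF : MeasurableSet F) (h0 : ∀ᵐ ω ∂P, ω ∉ F → f ω = 0) :
    eLpNorm f 2 P ≤ eLpNorm f p P * P F ^ (1 / 2 - 1 / p.toReal) := by
  have h1 : eLpNorm f 2 P = eLpNorm f 2 (P.restrict F) := by
    rw [← eLpNorm_indicator_eq_eLpNorm_restrict hF]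
    refine eLpNorm_congr_ae ?_
    filter_upwards [h0] with ω hω
    by_cases h : ω ∈ F
    · rw [Set.indicator_of_mem h]
    · rw [Set.indicator_of_notMem h, hω h]
  rw [h1]
  refine (eLpNorm_le_eLpNorm_mul_rpow_measure_univ hp hf.restrict).trans ?_
  rw [Measure.restrict_apply_univ]
  exact mul_le_mul' (eLpNorm_mono_measure f Measure.restrict_le_self) (by simp)

lemma UniformMomentBound.exists_eLpNorm_le {Z : ℕ → Ω → ℝ} (h : UniformMomentBound P Z) :
    ∃ p : ℝ≥0∞, 2 < p ∧ p ≠ ∞ ∧ ∃ C : ℝ≥0∞, C ≠ ∞ ∧ ∀ n, eLpNorm (Z n) p P ≤ C := by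
  obtain ⟨η, hη, D, hD⟩ := h
  have hp0 : (0 : ℝ) < 2 + η := by linarith
  refine ⟨ENNReal.ofReal (2 + η), ?_, ENNReal.ofReal_ne_top,
    ENNReal.ofReal D ^ (1 / (2 + η)), ?_, fun n => ?_⟩
  · rw [show (2 : ℝ≥0∞) = ENNReal.ofReal 2 by simp]
    exact (ENNReal.ofReal_lt_ofReal_iff hp0).2 (by linarith)
  · exact ENNReal.rpow_ne_top_of_nonneg (by positivity) ENNReal.ofReal_ne_top
  · rw [eLpNorm_eq_lintegral_rpow_enorm_toReal (by simpa using hp0) ENNReal.ofReal_ne_top,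
      ENNReal.toReal_ofReal hp0.le]
    refine ENNReal.rpow_le_rpow (le_trans (le_of_eq ?_) (hD n).le) (by positivity)
    refine lintegral_congr fun ω => ?_
    rw [← ENNReal.ofReal_rpow_of_nonneg (abs_nonneg _) hp0.le, ← Real.norm_eq_abs, ofReal_norm]

end Series

/-! ### The telescoping sum -/

lemma sum_min_mul_sub (b : ℕ → ℝ) (d : ℕ) (n : ℕ) :
    ∑ j ∈ Finset.range n, min 1 (((j : ℝ) + 1) / ((d : ℝ) + 1)) * (b (j + 1) - b j) =
      min 1 ((n : ℝ) / ((d : ℝ) + 1)) * b n -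
        1 / ((d : ℝ) + 1) * ∑ j ∈ Finset.range (min n (d + 1)), b j := by
  have hd : (0 : ℝ) < (d : ℝ) + 1 := by positivity
  induction n with
  | zero => simp
  | succ n ih =>
    rw [Finset.sum_range_succ, ih]
    push_cast
    rcases Nat.lt_or_ge n (d + 1) with h | h
    · have h1 : (n : ℝ) + 1 ≤ (d : ℝ) + 1 := by exact_mod_cast h
      rw [min_eq_right (a := (1 : ℝ)) (b := ((n : ℝ) + 1) / _) ((div_le_one hd).2 h1),
        min_eq_right (a := (1 : ℝ)) (b := (n : ℝ) / _) ((div_le_one hd).2 (by linarith)),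
        min_eq_left h.le, min_eq_left (Nat.succ_le_of_lt h), Finset.sum_range_succ]
      field_simp
      ring
    · have h1 : (d : ℝ) + 1 ≤ n := by exact_mod_cast h
      rw [min_eq_left (a := (1 : ℝ)) (b := ((n : ℝ) + 1) / _) ((one_le_div hd).2 (by linarith)),
        min_eq_left (a := (1 : ℝ)) (b := (n : ℝ) / _) ((one_le_div hd).2 h1),
        min_eq_right h, min_eq_right (h.trans n.le_succ)]
      ring

/-- The bias correction removes the bias of the ergodic average: the weighted increments sum to the
limit minus the average over the window. -/
lemma average_add_eq_of_tendsto {a : ℕ → ℝ} {θ S : ℝ} {k m : ℕ} (hkm : k ≤ m)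
    (ha : Filter.Tendsto a Filter.atTop (nhds θ))
    (hS : HasSum (fun j : ℕ => min 1 (((j : ℝ) + 1) / ((m : ℝ) - k + 1)) *
      (a (k + 1 + j) - a (k + j))) S) :
    1 / ((m : ℝ) - k + 1) * ∑ l ∈ Finset.Icc k m, a l + S = θ := by
  obtain ⟨d, rfl⟩ := Nat.exists_eq_add_of_le hkm
  have hd : ((k + d : ℕ) : ℝ) - k = d := by push_cast; ring
  rw [hd] at hS ⊢
  have h1 : ∑ l ∈ Finset.Icc k (k + d), a l = ∑ j ∈ Finset.range (d + 1), a (k + j) := by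
    rw [← Finset.Ico_add_one_right_eq_Icc, Finset.sum_Ico_eq_sum_range]
    congr 2; omega
  have h2 : Filter.Tendsto (fun n : ℕ => ∑ j ∈ Finset.range n,
      min 1 (((j : ℝ) + 1) / ((d : ℝ) + 1)) * (a (k + 1 + j) - a (k + j))) Filter.atTop
      (nhds (θ - 1 / ((d : ℝ) + 1) * ∑ j ∈ Finset.range (d + 1), a (k + j))) := by
    have h3 : Filter.Tendsto (fun n => a (k + n) -
        1 / ((d : ℝ) + 1) * ∑ j ∈ Finset.range (d + 1), a (k + j)) Filter.atTop
        (nhds (θ - 1 / ((d : ℝ) + 1) * ∑ j ∈ Finset.range (d + 1), a (k + j))) := by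
      refine Filter.Tendsto.sub_const ?_ _
      simpa only [add_comm k] using (Filter.tendsto_add_atTop_iff_nat k).2 ha
    refine h3.congr' ?_
    filter_upwards [Filter.eventually_ge_atTop (d + 1)] with n hn
    have h4 := sum_min_mul_sub (fun j => a (k + j)) d n
    have h5 : (1 : ℝ) ≤ (n : ℝ) / ((d : ℝ) + 1) := by
      rw [one_le_div (by positivity)]; exact_mod_cast hn
    rw [min_eq_left h5, min_eq_right hn, one_mul] at h4
    rw [← h4]
    refine Finset.sum_congr rfl fun j _ => ?_
    rw [show k + 1 + j = k + (j + 1) by ring]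
  have h6 := tendsto_nhds_unique hS.tendsto_sum_nat h2
  rw [h1, h6]
  ring

/-- Since the chains agree from the meeting time on, the correction term of the estimator may be
summed over all iterations. -/
lemma hasSum_timeAveraged {k m : ℕ} {τ : ℕ∞} (hτ : τ ≠ ⊤) {φ φ' : ℕ → ℝ}
    (h : ∀ l : ℕ, τ ≤ (l + 1 : ℕ) → φ (l + 1) = φ' l) :
    HasSum (fun j : ℕ => min 1 (((j : ℝ) + 1) / ((m : ℝ) - k + 1)) *
      (φ (k + 1 + j) - φ' (k + j)))
      (timeAveraged k m τ φ φ' - 1 / ((m : ℝ) - k + 1) * ∑ l ∈ Finset.Icc k m, φ l) := by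
  obtain ⟨t, rfl⟩ := ENat.ne_top_iff_exists.1 hτ
  have h1 : timeAveraged k m t φ φ' - 1 / ((m : ℝ) - k + 1) * ∑ l ∈ Finset.Icc k m, φ l =
      ∑ j ∈ Finset.range (t - (k + 1)), min 1 (((j : ℝ) + 1) / ((m : ℝ) - k + 1)) *
        (φ (k + 1 + j) - φ' (k + j)) := by
    rw [timeAveraged, add_sub_cancel_left, ENat.toNat_natCast, Finset.sum_Ico_eq_sum_range]
    refine Finset.sum_congr rfl fun j _ => ?_
    rw [show k + 1 + j - 1 = k + j by omega]
    congr 3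
    push_cast; ring
  rw [h1]
  refine hasSum_sum_of_ne_finset_zero fun j hj => ?_
  rw [show k + 1 + j = k + j + 1 by ring, h (k + j), sub_self, mul_zero]
  have : ¬ j < t - (k + 1) := fun hlt => hj (Finset.mem_range.2 hlt)
  exact_mod_cast (by omega : t ≤ k + j + 1)

/-! ### Unbiasedness of the coupled estimator -/

section Estimator

variable {X : Type*} [MeasurableSpace X] {N L : ℕ} {Ω : Type*} [MeasurableSpace Ω] {P : Measure Ω}
  [IsProbabilityMeasure P] {Λ : Measure (PFRun X N L)} {ξ : ℕ → Ω → PFRun X N L} {u : ℕ → Ω → ℝ}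
  {B : ℝ}

/-- The coupled estimator of the mean of `G` under the normalised target is unbiased and has finite
variance as soon as `G` has bounded moments of some order above `2` along the first chain. -/
theorem IIDInputs.unbiasedFiniteVariance_timeAveraged (h : IIDInputs P Λ ξ u)
    (hΛ : RegularProposal Λ B) {G : PFRun X N L → ℝ} (hG : Measurable G)
    (hmom : UniformMomentBound P fun n ω => G (chain (ξ · ω) (u · ω) n)) {k m : ℕ} (hkm : k ≤ m) :
    Integrable G (target Λ) ∧
      UnbiasedFiniteVariance P
        (fun ω => timeAveraged k m (meetingTime (ξ · ω) (u · ω))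
          (fun l => G (chain (ξ · ω) (u · ω) l)) (fun l => G (lagChain (ξ · ω) (u · ω) l)))
        ((target Λ Set.univ).toReal⁻¹ * ∫ v, G v ∂(target Λ)) := by
  have := hΛ.isProb
  obtain ⟨p, hp2, hptop, C, hC, hCn⟩ := hmom.exists_eLpNorm_le
  have hm1 : ∀ l, Measurable fun ω => G (chain (ξ · ω) (u · ω) l) :=
    fun l => hG.comp (h.measurable_chain l)
  have hlag : ∀ l, Measurable fun ω => lagChain (ξ · ω) (u · ω) l := fun l => by
    simp only [lagChain_eq_chain]
    exact h.shift.measurable_chain l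
  have hm2 : ∀ l, Measurable fun ω => G (lagChain (ξ · ω) (u · ω) l) := fun l => hG.comp (hlag l)
  have hCn' : ∀ n, eLpNorm (fun ω => G (lagChain (ξ · ω) (u · ω) n)) p P ≤ C := fun n => by
    refine le_trans (le_of_eq ?_) (hCn n)
    have h1 := eLpNorm_map_measure (p := p) (μ := P) hG.aestronglyMeasurable
      (hlag n).aemeasurable
    have h2 := eLpNorm_map_measure (p := p) (μ := P) hG.aestronglyMeasurable
      (h.measurable_chain n).aemeasurable
    rw [h.map_lagChain n] at h1
    exact h1.symm.trans h2
  have hle : ∀ {Z : Ω → ℝ}, Measurable Z → eLpNorm Z 2 P ≤ eLpNorm Z p P := fun hZ =>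
    eLpNorm_le_eLpNorm_of_exponent_le hp2.le hZ.aestronglyMeasurable
  obtain ⟨hint, hlim⟩ := h.tendsto_integral_chain hΛ hG hC fun n => (hle (hm1 n)).trans (hCn n)
  refine ⟨hint, ?_⟩
  have hL2 : ∀ l, MemLp (fun ω => G (chain (ξ · ω) (u · ω) l)) 2 P := fun l =>
    ⟨(hm1 l).aestronglyMeasurable, (hle (hm1 l)).trans_lt ((hCn l).trans_lt hC.lt_top)⟩
  have hL2' : ∀ l, MemLp (fun ω => G (lagChain (ξ · ω) (u · ω) l)) 2 P := fun l =>
    ⟨(hm2 l).aestronglyMeasurable, (hle (hm2 l)).trans_lt ((hCn' l).trans_lt hC.lt_top)⟩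
  have hmean : ∀ l, ∫ ω, G (lagChain (ξ · ω) (u · ω) l) ∂P =
      ∫ ω, G (chain (ξ · ω) (u · ω) l) ∂P := fun l => by
    rw [← integral_map (hlag l).aemeasurable hG.aestronglyMeasurable, h.map_lagChain l,
      integral_map (h.measurable_chain l).aemeasurable hG.aestronglyMeasurable]
  have hd : (0 : ℝ) < (m : ℝ) - k + 1 := by
    have : (k : ℝ) ≤ m := by exact_mod_cast hkm
    linarith
  -- `f j` vanishes once the chains have met, and failing to meet is geometrically rare
  obtain ⟨f, hf⟩ : ∃ f : ℕ → Ω → ℝ, ∀ j, f j = fun ω =>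
    min 1 (((j : ℝ) + 1) / ((m : ℝ) - k + 1)) *
      (G (chain (ξ · ω) (u · ω) (k + 1 + j)) - G (lagChain (ξ · ω) (u · ω) (k + j))) :=
    ⟨_, fun _ => rfl⟩
  have hfm : ∀ j, Measurable (f j) := fun j => by
    rw [hf]; exact ((hm1 _).sub (hm2 _)).const_mul _
  set q := 1 - minAccept Λ B with hqdef
  have hq : q < 1 := ENNReal.sub_lt_self ENNReal.one_ne_top one_ne_zero (minAccept_pos hΛ).ne'
  set s := 1 / 2 - 1 / p.toReal with hs
  have hs0 : 0 < s := by
    have h2 : (2 : ℝ) < p.toReal := by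
      simpa using (ENNReal.toReal_lt_toReal (by simp) hptop).2 hp2
    rw [hs, sub_pos]
    exact one_div_lt_one_div_of_lt two_pos h2
  have hqs : q ^ s < 1 := ENNReal.rpow_lt_one hq hs0
  have hfb : ∀ j, eLpNorm (f j) 2 P ≤ (C + C) * (q ^ s) ^ j := fun j => by
    have h1 : eLpNorm (f j) p P ≤ C + C := by
      have h2 : eLpNorm (f j) p P ≤ eLpNorm (fun ω => G (chain (ξ · ω) (u · ω) (k + 1 + j)) -
          G (lagChain (ξ · ω) (u · ω) (k + j))) p P := by
        refine eLpNorm_mono fun ω => ?_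
        rw [hf, norm_mul]
        refine mul_le_of_le_one_left (norm_nonneg _) ?_
        rw [Real.norm_of_nonneg (le_min zero_le_one (by positivity))]
        exact min_le_left _ _
      refine h2.trans ((eLpNorm_sub_le (hm1 _).aestronglyMeasurable (hm2 _).aestronglyMeasurable
        (one_le_two.trans hp2.le)).trans (add_le_add (hCn _) (hCn' _)))
    have h0 : ∀ᵐ ω ∂P, ω ∉ rejectSet ξ u B (k + j + 1) → f j ω = 0 := by
      filter_upwards [h.ae_mem_rejectSet hΛ] with ω hω hnot
      have h3 : meetingTime (ξ · ω) (u · ω) ≤ (k + j + 1 : ℕ) :=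
        not_lt.1 fun hlt => hnot (hω _ hlt)
      simp only [hf]
      rw [show k + 1 + j = k + j + 1 by ring, chain_eq_lagChain h3, sub_self, mul_zero]
    refine (eLpNorm_two_le_of_ae_eq_zero (hfm j).aestronglyMeasurable hp2.le
      (h.measurableSet_rejectSet _) h0).trans (mul_le_mul' h1 ?_)
    rw [h.measure_rejectSet hΛ, ← hqdef, ← hs, ← ENNReal.rpow_natCast, ← ENNReal.rpow_mul, mul_comm,
      ENNReal.rpow_mul, ENNReal.rpow_natCast]
    exact pow_le_pow_right_of_le_one' hqs.le (by omega)
  have hsum : ∑' j, eLpNorm (f j) 2 P ≠ ∞ := by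
    refine ne_top_of_le_ne_top ?_ (ENNReal.tsum_le_tsum hfb)
    rw [ENNReal.tsum_mul_left, ENNReal.tsum_geometric]
    exact ENNReal.mul_ne_top (by simpa using hC) (ENNReal.inv_ne_top.2 (tsub_pos_of_lt hqs).ne')
  obtain ⟨A, hA⟩ : ∃ A : Ω → ℝ, A = fun ω => 1 / ((m : ℝ) - k + 1) *
    ∑ l ∈ Finset.Icc k m, G (chain (ξ · ω) (u · ω) l) := ⟨_, rfl⟩
  have hHs : ∀ᵐ ω ∂P, HasSum (f · ω) (timeAveraged k m (meetingTime (ξ · ω) (u · ω))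
      (fun l => G (chain (ξ · ω) (u · ω) l)) (fun l => G (lagChain (ξ · ω) (u · ω) l)) - A ω) := by
    filter_upwards [h.ae_meetingTime_ne_top hΛ] with ω hω
    have h1 := hasSum_timeAveraged (k := k) (m := m) hω
      (φ := fun l => G (chain (ξ · ω) (u · ω) l)) (φ' := fun l => G (lagChain (ξ · ω) (u · ω) l))
      fun l hl => congrArg G (chain_eq_lagChain hl)
    simp only [hf, hA]
    exact h1
  obtain ⟨H, hH⟩ : ∃ H : Ω → ℝ, H = fun ω => timeAveraged k m (meetingTime (ξ · ω) (u · ω))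
    (fun l => G (chain (ξ · ω) (u · ω) l)) (fun l => G (lagChain (ξ · ω) (u · ω) l)) := ⟨_, rfl⟩
  rw [← hH]
  replace hHs : ∀ᵐ ω ∂P, HasSum (f · ω) (H ω - A ω) := by rw [hH]; exact hHs
  obtain ⟨hR2, hRsum⟩ := memLp_and_hasSum_integral (fun j => (hfm j).aestronglyMeasurable) hsum hHs
  have hA2 : MemLp A 2 P := by
    rw [hA]
    have h1 : MemLp (fun ω => ∑ l ∈ Finset.Icc k m, G (chain (ξ · ω) (u · ω) l)) 2 P :=
      memLp_finsetSum (Finset.Icc k m) fun l _ => hL2 l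
    exact h1.const_mul (1 / ((m : ℝ) - k + 1))
  have hHA : H = fun ω => A ω + (H ω - A ω) := by ext ω; ring
  refine ⟨by rw [hHA]; exact hA2.add hR2, ?_⟩
  have hAmean : ∫ ω, A ω ∂P = 1 / ((m : ℝ) - k + 1) *
      ∑ l ∈ Finset.Icc k m, ∫ ω, G (chain (ξ · ω) (u · ω) l) ∂P := by
    rw [hA, integral_const_mul, integral_finsetSum _ fun l _ => (hL2 l).integrable one_le_two]
  rw [hHA, integral_add (hA2.integrable one_le_two) (hR2.integrable one_le_two), hAmean]
  refine average_add_eq_of_tendsto hkm hlim ?_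
  convert hRsum using 2 with j
  simp only [hf]
  rw [integral_const_mul, integral_sub ((hL2 _).integrable one_le_two)
    ((hL2' _).integrable one_le_two), hmean]

end Estimator

/-! ### The target of the chain and the smoothing distribution -/

section Smoothing

variable {X Y : Type*} [MeasurableSpace X] [MeasurableSpace Y] {ν : Measure X} {ρ : Measure Y}
  (M : StateSpaceModel ν ρ) (Q : Proposal ν) (y : ℕ → Y) {N L : ℕ}
  (r : Kernel (Fin N → ℝ) (Fin N → Fin N))

lemma measurable_path : Measurable (PFRun.path (X := X) (N := N) (L := L)) :=
  measurable_from_prod_countable_left fun j =>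
    (measurable_pi_apply (X := fun _ : Fin N => Fin (L + 1) → X) j).comp measurable_fst

lemma measurable_piN {h : (Fin (L + 1) → X) → ℝ} (hh : Measurable h) :
    Measurable (PFRun.piN (N := N) h) := by
  unfold PFRun.piN
  fun_prop

lemma lintegral_pfRunLaw {φ : PFRun X N L → ℝ≥0∞} (hφ : Measurable φ) :
    ∫⁻ v, φ v ∂(pfRunLaw M Q y r L) =
      ∫⁻ s, ∑ j, ENNReal.ofReal (s.2.1 j) * φ (s, j) ∂(pfLaw M Q y r L) := by
  have hm : Measurable fun s : PFState X N L =>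
      ∑ j : Fin N, ENNReal.ofReal (s.2.1 j) • Measure.dirac (s, j) := by
    refine Measure.measurable_of_measurable_coe _ fun A hA => ?_
    simp only [Measure.coe_finsetSum, Measure.coe_smul, Finset.sum_apply, Pi.smul_apply,
      Measure.dirac_apply' _ hA, smul_eq_mul]
    refine Finset.measurable_sum _ fun j _ => Measurable.mul (by fun_prop) ?_
    exact (measurable_one.indicator hA).comp measurable_prodMk_right
  rw [pfRunLaw, Measure.lintegral_bind hm.aemeasurable hφ.aemeasurable]
  refine lintegral_congr fun s => ?_
  simp only [lintegral_finsetSum_measure, lintegral_smul_measure, lintegral_dirac' _ hφ,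
    smul_eq_mul]

lemma lintegral_target_pfRunLaw {φ : PFRun X N L → ℝ≥0∞} (hφ : Measurable φ) :
    ∫⁻ v, φ v ∂(target (pfRunLaw M Q y r L)) =
      ∫⁻ s, ENNReal.ofReal s.2.2 * ∑ j, ENNReal.ofReal (s.2.1 j) * φ (s, j)
        ∂(pfLaw M Q y r L) := by
  have hm : Measurable fun v : PFRun X N L => ENNReal.ofReal v.pN * φ v :=
    measurable_pN.ennreal_ofReal.mul hφ
  rw [lintegral_target hφ, lintegral_pfRunLaw M Q y r hm]
  refine lintegral_congr fun s => ?_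
  rw [Finset.mul_sum]
  refine Finset.sum_congr rfl fun j _ => ?_
  rw [mul_left_comm]
  rfl

lemma ae_pfRunLaw {p : PFState X N L → Prop} (hp : MeasurableSet {s | p s})
    (h : ∀ᵐ s ∂(pfLaw M Q y r L), p s) : ∀ᵐ v ∂(pfRunLaw M Q y r L), p v.1 := by
  have hA : MeasurableSet {v : PFRun X N L | ¬ p v.1} := measurable_fst hp.compl
  rw [ae_iff, ← lintegral_indicator_one hA,
    lintegral_pfRunLaw M Q y r (measurable_one.indicator hA)]
  refine (lintegral_congr_ae ?_).trans lintegral_zero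
  filter_upwards [h] with s hs
  refine Finset.sum_eq_zero fun j _ => ?_
  rw [Set.indicator_of_notMem (by simpa using hs), mul_zero]

variable [SigmaFinite ν]

/-- Under the target of the chain the sampled path has the unnormalised smoothing law. -/
lemma map_path_target (hN : 1 ≤ N) (hpos : WeightsPositive M Q y (L + 1))
    (hbdd : WeightsBounded M Q y (L + 1)) (hr : UnbiasedResampling r) :
    (target (pfRunLaw M Q y r L)).map PFRun.path = jointMeasure M y L := by
  refine Measure.ext_of_lintegral _ fun Φ hΦ => ?_
  have hm : Measurable fun v : PFRun X N L => Φ v.path := hΦ.comp measurable_path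
  rw [lintegral_map hΦ measurable_path, lintegral_target_pfRunLaw M Q y r hm,
    ← lintegral_unnormalisedEstimate M Q y r hN hpos hbdd hr L le_rfl hΦ]
  rfl

/-- Averaging over the particles does not change means under the target of the chain, because the
index of the sampled path is distributed according to the weights. -/
lemma lintegral_sum_weights_target (hN : 1 ≤ N) (hpos : WeightsPositive M Q y (L + 1))
    (hbdd : WeightsBounded M Q y (L + 1)) (hr : UnbiasedResampling r)
    {Φ : (Fin (L + 1) → X) → ℝ≥0∞} (hΦ : Measurable Φ) :
    ∫⁻ v, ∑ i, ENNReal.ofReal (v.1.2.1 i) * Φ (v.1.1 i) ∂(target (pfRunLaw M Q y r L)) =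
      ∫⁻ x, Φ x ∂(jointMeasure M y L) := by
  rw [lintegral_target_pfRunLaw M Q y r (by fun_prop),
    ← lintegral_unnormalisedEstimate M Q y r hN hpos hbdd hr L le_rfl hΦ]
  obtain ⟨B, hB⟩ := ae_regularState M Q y r hN hpos hbdd L le_rfl
  refine lintegral_congr_ae ?_
  filter_upwards [hB] with s hs
  have hW : ∑ j, ENNReal.ofReal (s.2.1 j) = 1 := by
    rw [← ENNReal.ofReal_sum_of_nonneg fun j _ => hs.2.2.1 j, hs.2.2.2, ENNReal.ofReal_one]
  rw [← Finset.sum_mul, hW, one_mul]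
  rfl

lemma integral_piN_target (hN : 1 ≤ N) (hpos : WeightsPositive M Q y (L + 1))
    (hbdd : WeightsBounded M Q y (L + 1)) (hr : UnbiasedResampling r)
    {h : (Fin (L + 1) → X) → ℝ} (hh : Measurable h) (hint : Integrable h (jointMeasure M y L)) :
    ∫ v, PFRun.piN h v ∂(target (pfRunLaw M Q y r L)) = ∫ x, h x ∂(jointMeasure M y L) := by
  have key : ∀ {g : (Fin (L + 1) → X) → ℝ}, Measurable g → Integrable g (jointMeasure M y L) →
      Integrable (fun v : PFRun X N L =>
        (∑ i, ENNReal.ofReal (v.1.2.1 i) * ENNReal.ofReal (g (v.1.1 i))).toReal)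
          (target (pfRunLaw M Q y r L)) ∧
      ∫ v : PFRun X N L, (∑ i, ENNReal.ofReal (v.1.2.1 i) * ENNReal.ofReal (g (v.1.1 i))).toReal
        ∂(target (pfRunLaw M Q y r L)) =
        (∫⁻ x, ENNReal.ofReal (g x) ∂(jointMeasure M y L)).toReal := fun {g} hg hgi => by
    have hm : Measurable fun v : PFRun X N L =>
        ∑ i, ENNReal.ofReal (v.1.2.1 i) * ENNReal.ofReal (g (v.1.1 i)) := by fun_prop
    have h1 := lintegral_sum_weights_target M Q y r hN hpos hbdd hr hg.ennreal_ofReal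
    refine ⟨integrable_toReal_of_lintegral_ne_top hm.aemeasurable ?_, ?_⟩
    · rw [h1]
      exact hgi.lintegral_lt_top.ne
    · rw [integral_toReal hm.aemeasurable, h1]
      refine Filter.Eventually.of_forall fun v => ?_
      exact ENNReal.sum_lt_top.2 fun i _ =>
        ENNReal.mul_lt_top ENNReal.ofReal_lt_top ENNReal.ofReal_lt_top
  obtain ⟨h1, h2⟩ := key hh hint
  obtain ⟨h3, h4⟩ := key hh.neg hint.neg
  rw [integral_eq_lintegral_pos_part_sub_lintegral_neg_part hint]
  simp only [Pi.neg_apply] at h3 h4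
  rw [← h2, ← h4, ← integral_sub h1 h3]
  obtain ⟨B, hB⟩ := ae_regularState M Q y r hN hpos hbdd L le_rfl
  refine integral_congr_ae ?_
  filter_upwards [target_absolutelyContinuous
    (ae_pfRunLaw M Q y r (measurableSet_regularState B) hB)] with v hv
  rw [PFRun.piN, ENNReal.toReal_sum fun i _ =>
      ENNReal.mul_ne_top ENNReal.ofReal_ne_top ENNReal.ofReal_ne_top,
    ENNReal.toReal_sum fun i _ => ENNReal.mul_ne_top ENNReal.ofReal_ne_top ENNReal.ofReal_ne_top,
    ← Finset.sum_sub_distrib]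
  refine Finset.sum_congr rfl fun i _ => ?_
  rw [ENNReal.toReal_mul, ENNReal.toReal_mul, ← mul_sub, ENNReal.toReal_ofReal (hv.2.2.1 i),
    ENNReal.toReal_ofReal', ENNReal.toReal_ofReal', max_zero_sub_max_neg_zero_eq_self]

lemma exists_regularProposal_pfRunLaw (hN : 1 ≤ N) (hpos : WeightsPositive M Q y (L + 1))
    (hbdd : WeightsBounded M Q y (L + 1)) [IsProbabilityMeasure (pfRunLaw M Q y r L)] :
    ∃ B, RegularProposal (pfRunLaw M Q y r L) B := by
  obtain ⟨B, hB⟩ := ae_regularState M Q y r hN hpos hbdd L le_rfl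
  have h1 := ae_pfRunLaw M Q y r (measurableSet_regularState B) hB
  exact ⟨B, inferInstance, h1.mono fun v hv => hv.1, h1.mono fun v hv => hv.2.1⟩

end Smoothing

end CoupledPIMH

open CoupledPIMH in
theorem mainTheorem1 {X Y : Type*} [MeasurableSpace X] [MeasurableSpace Y]
    (ν : Measure X) [SigmaFinite ν] (ρ : Measure Y) [SigmaFinite ρ]
    (M : StateSpaceModel ν ρ) (Q : Proposal ν) (y : ℕ → Y) (L : ℕ)
    {N : ℕ} (hN : 1 ≤ N)
    (r : Kernel (Fin N → ℝ) (Fin N → Fin N)) [IsMarkovKernel r]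
    (hpos : WeightsPositive M Q y (L + 1))
    -- unbiased resampling and bounded incremental weights
    (hr : UnbiasedResampling r) (hbdd : WeightsBounded M Q y (L + 1))
    (h : (Fin (L + 1) → X) → ℝ) (hh : Measurable h)
    (k m : ℕ) (hkm : k ≤ m)
    -- the random inputs of the algorithm: independent calls to the particle filter and uniforms
    {Ω : Type*} [MeasurableSpace Ω] (P : Measure Ω) [IsProbabilityMeasure P]
    (ξ : ℕ → Ω → PFRun X N L) (u : ℕ → Ω → ℝ)
    (hξ : ∀ n, Measurable (ξ n)) (hu : ∀ n, Measurable (u n))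
    (hlaw : ∀ n, P.map (fun ω => (ξ n ω, u n ω)) =
      (pfRunLaw M Q y r L).prod (volume.restrict (Set.Icc (0 : ℝ) 1)))
    (hind : iIndepFun (fun n ω => (ξ n ω, u n ω)) P) :
    (UniformMomentBound P (fun n ω => h (chain (ξ · ω) (u · ω) n).path) →
      Integrable h (smoothing M y L) ∧
      UnbiasedFiniteVariance P (fun ω => estimator h k m (ξ · ω) (u · ω))
        (∫ x, h x ∂(smoothing M y L)) ∧
      ∫⁻ ω, (cost m (ξ · ω) (u · ω) : ℝ≥0∞) ∂P < ∞) ∧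
    (Integrable h (smoothing M y L) →
      UniformMomentBound P (fun n ω => (chain (ξ · ω) (u · ω) n).piN h) →
      UnbiasedFiniteVariance P (fun ω => rbEstimator h k m (ξ · ω) (u · ω))
        (∫ x, h x ∂(smoothing M y L)) ∧
      ∫⁻ ω, (cost m (ξ · ω) (u · ω) : ℝ≥0∞) ∂P < ∞) := by
  have hin : IIDInputs P (pfRunLaw M Q y r L) ξ u :=
    ⟨fun n => (hξ n).prodMk (hu n), hlaw, hind⟩
  -- the total mass of the law of a run is read off from the given law of the inputs
  have hprob : IsProbabilityMeasure (pfRunLaw M Q y r L) := ⟨by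
    have h1 := congrArg (fun m => m Set.univ) (hlaw 0)
    rw [Measure.map_apply (hin.measurable 0) .univ, Set.preimage_univ, measure_univ,
      Measure.prod_apply .univ] at h1
    simpa using h1.symm⟩
  obtain ⟨B, hΛ⟩ := exists_regularProposal_pfRunLaw M Q y r hN hpos hbdd
  have hmap := map_path_target M Q y r hN hpos hbdd hr
  have hZ : target (pfRunLaw M Q y r L) Set.univ = jointMeasure M y L Set.univ := by
    rw [← hmap, Measure.map_apply measurable_path .univ, Set.preimage_univ]
  have hZ0 : jointMeasure M y L Set.univ ≠ 0 := hZ ▸ hΛ.target_univ_pos.ne'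
  have hZtop : jointMeasure M y L Set.univ ≠ ∞ :=
    hZ ▸ (hΛ.target_univ_le.trans_lt ENNReal.ofReal_lt_top).ne
  have hmean : ∫ x, h x ∂(smoothing M y L) =
      (target (pfRunLaw M Q y r L) Set.univ).toReal⁻¹ * ∫ x, h x ∂(jointMeasure M y L) := by
    rw [smoothing, integral_smul_measure, ENNReal.toReal_inv, hZ, smul_eq_mul]
  rw [hmean]
  refine ⟨fun hmom => ?_, fun hint hmom => ?_⟩
  · obtain ⟨h1, h2⟩ := hin.unbiasedFiniteVariance_timeAveraged hΛ
      (G := fun v => h v.path) (hh.comp measurable_path) hmom hkm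
    refine ⟨?_, ?_, hin.lintegral_cost_lt_top hΛ m⟩
    · refine Integrable.smul_measure ?_ (ENNReal.inv_ne_top.2 hZ0)
      rw [← hmap, integrable_map_measure hh.aestronglyMeasurable measurable_path.aemeasurable]
      exact h1
    · rw [← hmap, integral_map measurable_path.aemeasurable hh.aestronglyMeasurable]
      exact h2
  · have hint' : Integrable h (jointMeasure M y L) :=
      (integrable_smul_measure (ENNReal.inv_ne_zero.2 hZtop) (ENNReal.inv_ne_top.2 hZ0)).1 hint
    obtain ⟨-, h2⟩ := hin.unbiasedFiniteVariance_timeAveraged hΛ (measurable_piN hh) hmom hkm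
    refine ⟨?_, hin.lintegral_cost_lt_top hΛ m⟩
    rw [← integral_piN_target M Q y r hN hpos hbdd hr hh hint']
    exact h2
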